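/- Let $\Phi=\{x_i\}$ be a homogeneous Poisson point process on $\mathbb{R}^2$ with intensity $\lambda>0$, let $\alpha>2$ and $0<\phi\le 2\pi$, and let the channel gains $h_i>0$ be i.i.d. copies of a random variable $h$, independent of $\Phi$, with $\mathbb{E}[h^{2/\alpha}]<\infty$. For a receiver at $x\in\mathbb{R}^2$ with reception angle $\phi$, the interferers are the nodes $x_i$ for which the angle in $[0,2\pi)$ of the vector $x_i-x$ with respect to the horizontal axis is at most $\phi$. Let $z_1\le z_2\le\cdots$ be the numbers $\|x_i-x\|^{\alpha}/h_i$ (the inverses of the received interference powers), taken over all interferers and arranged in ascending order; almost surely this arrangement exists and is strictly increasing. Then for every $n\ge 1$ the partial accumulative interference $$\mathcal{I}(n)=\sum_{k=n+1}^{\infty}\frac1{z_k}$$ (the total interference of all but the $n$ dominant interferers) converges almost surely, and its conditional Laplace transform given $z_n$ is, almost surely, for all $s>0$, $$\mathbb{E}\left[e^{-s\,\mathcal{I}(n)}\,\middle|\,z_n\right]=\exp\left\{\frac{\phi\lambda}{\alpha}\,\mathbb{E}\left[h^{2/\alpha}\right]q_{z_n}(s)\right\},\qquad q_{z_n}(s)=s^{2/\alpha}\,\gamma\left(-\frac{2}{\alpha},\frac{s}{z_n}\right)+\frac{\alpha}{2}\,z_n^{2/\alpha},$$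 where $\gamma(a,y)=\Gamma(a)-\int_y^{\infty}t^{a-1}e^{-t}\,dt$ is the lower incomplete gamma function, continued analytically in $a$ to $a\in(-1,0)$. -/

import Mathlib

open MeasureTheory ProbabilityTheory Set
open scoped ENNReal

noncomputable section

namespace PoissonNetwork

/-- The Euclidean plane. -/
abbrev Plane : Type := EuclideanSpace ℝ (Fin 2)

/-- The sequence of random points `X 0, X 1, …` of `E` is (an enumeration of) a Poisson point
process with intensity measure `Λ`: the number of points in a measurable set `A` of finite
intensity is Poisson distributed with mean `Λ A`, and the numbers of points in pairwise disjoint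
measurable sets are independent. -/
structure IsPoissonPointProcess {Ω E : Type*} [MeasurableSpace Ω] [MeasurableSpace E]
    (P : Measure Ω) (Λ : Measure E) (X : ℕ → Ω → E) : Prop where
  measurable : ∀ i, Measurable (X i)
  poisson_count : ∀ A : Set E, MeasurableSet A → Λ A ≠ ∞ →
    P.map (fun ω => {i : ℕ | X i ω ∈ A}.encard) =
      (poissonMeasure (Λ A).toNNReal).map (fun k : ℕ => (k : ℕ∞))
  indep_count : ∀ (m : ℕ) (A : Fin m → Set E), (∀ j, MeasurableSet (A j)) →
    Pairwise (fun j k => Disjoint (A j) (A k)) →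
    iIndepFun (fun j ω => {i : ℕ | X i ω ∈ A j}.encard) P

/-- The angle in `[0, 2π)` between the vector `v` and the (positive) horizontal axis. -/
def polarAngle (v : Plane) : ℝ :=
  toIcoMod Real.two_pi_pos 0 (Complex.arg ⟨v 0, v 1⟩)

section Network

variable {Ω : Type*} (x : Plane) (φ α : ℝ) (X : ℕ → Ω → Plane) (h : ℕ → Ω → ℝ)

/-- The (indices of the) interferers of the receiver at `x`: the nodes seen from `x` within the
reception angle `φ`. -/
def interferers (ω : Ω) : Set ℕ :=
  {i | polarAngle (X i ω - x) ≤ φ}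

/-- The inverse received power `‖Xᵢ - x‖ ^ α / hᵢ` of node `i` at the receiver `x`. -/
def inversePower (i : ℕ) (ω : Ω) : ℝ :=
  ‖X i ω - x‖ ^ α / h i ω

/-- The point process, on the power axis, of the inverse powers of all interferers. -/
def powerPoints (ω : Ω) : Set ℝ :=
  (fun i => inversePower x α X h i ω) '' interferers x φ X ω

/-- `z n`, the `n`-th smallest inverse power (`n = 1, 2, …`): the least level `t` such that at
least `n` interferers have inverse power at most `t`. -/
def z (n : ℕ) (ω : Ω) : ℝ :=
  sInf {t : ℝ | (n : ℕ∞) ≤ {i ∈ interferers x φ X ω | inversePower x α X h i ω ≤ t}.encard}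

/-- The partial accumulative interference `∑_{k > n} 1 / z k`, which leaves out the `n` dominant
interferers. -/
def partialInterference (n : ℕ) (ω : Ω) : ℝ :=
  ∑' k : ℕ, (z x φ α X h (n + 1 + k) ω)⁻¹

end Network

/-- The lower incomplete gamma function `γ(a, y)` for `y > 0` and real `a ≠ 0, -1, -2, …`, that is
`Γ(a) - ∫_y^∞ t^(a-1) e^(-t) dt`. For `a > 0` this is `∫_0^y t^(a-1) e^(-t) dt`; for other `a` it
is the analytic continuation in `a` (`Real.Gamma` is the continued gamma function). -/
def lowerGamma (a y : ℝ) : ℝ :=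
  Real.Gamma a - ∫ t in Ioi y, t ^ (a - 1) * Real.exp (-t)

/-- `q_t(s) = s^(2/α) γ(-2/α, s/t) + (α/2) t^(2/α)`. -/
def q (α t s : ℝ) : ℝ :=
  s ^ (2 / α) * lowerGamma (-(2 / α)) (s / t) + α / 2 * t ^ (2 / α)

end PoissonNetwork

end

/-! For a fixed gain `η`, the interferers with inverse power at most `t` fill a circular sector of
angle `φ` and radius `(t η)^(1/α)`. Averaging its area over the gains shows that the inverse powers
behave as a Poisson process on `(0, ∞)` with intensity `κ y^(2/α - 1) dy`, `κ = (φ λ / α)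
E[h^(2/α)]`. All later arguments use only the Laplace functional of this process
(`HasPoissonLaplace`), which follows from that of the marked planar process
(`IsPoissonPointProcess.lintegral_infProd_marked`) and the image intensity (`map_inversePower`).

The intensity is finite below every level, infinite in total and diffuse, so almost surely the
points are distinct and can be listed in increasing order (`HasPoissonLaplace.ae_isOrderable`). The
functional factors over functions with disjoint supports, so the number of points in a set is
independent of a sum over its complement (`setLIntegral_expNeg_pointSum`). For `a ≤ b` the event `z
n ≤ a` says that `(-∞, a]` holds at least `n` points; hence it is independent of the sum of `s / y`
over points `y > b`. The Laplace transform of that sum is `exp(-κ ∫_b^∞ (1 - e^(-s/y)) y^(2/α - 1)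
dy) = exp(κ q_b(s))`, because `q` is a primitive in `b` of the integrand that vanishes at infinity.

To pass from a fixed level `b` to the random level `z n`, the latter is approximated from above by
levels with countably many values. No point lies strictly between `z n` and `z (n + 1)`, so the tail
sum is eventually the exact one (`setLIntegral_tailPower_orderStat`). The resulting identities over
all events `z n ∈ B` determine the conditional transform for each `s`; rational `s` and continuity
give all `s > 0` at once (`ae_integral_exp_condDistrib`). -/

noncomputable section

namespace PoissonNetwork

open Filter Topology

/-! ### Exponentials and infinite products with values in `[0, 1]`. -/

/-- The decreasing exponential `x ↦ e^(-x)` on `[0, ∞]`. -/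
def expNeg (x : ℝ≥0∞) : ℝ≥0∞ := EReal.exp (-(x : EReal))

@[simp] lemma expNeg_zero : expNeg 0 = 1 := by simp [expNeg]

@[simp] lemma expNeg_top : expNeg ∞ = 0 := by simp [expNeg]

lemma expNeg_add (x y : ℝ≥0∞) : expNeg (x + y) = expNeg x * expNeg y := by
  rw [expNeg, EReal.coe_ennreal_add, EReal.neg_add, sub_eq_add_neg, EReal.exp_add]
  · rfl
  · left; exact EReal.coe_ennreal_ne_bot x
  · right; exact EReal.coe_ennreal_ne_bot y

lemma antitone_expNeg : Antitone expNeg := fun x y h => by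
  simpa [expNeg] using h

lemma strictAnti_expNeg : StrictAnti expNeg := fun x y h => by
  simpa [expNeg] using h

lemma continuous_expNeg : Continuous expNeg :=
  ENNReal.continuous_exp.comp (continuous_neg.comp continuous_coe_ennreal_ereal)

@[fun_prop]
lemma measurable_expNeg : Measurable expNeg := antitone_expNeg.measurable

lemma expNeg_le_one (x : ℝ≥0∞) : expNeg x ≤ 1 := by
  simpa using antitone_expNeg (zero_le (a := x))

lemma expNeg_ofReal {r : ℝ} (hr : 0 ≤ r) :
    expNeg (ENNReal.ofReal r) = ENNReal.ofReal (Real.exp (-r)) := by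
  rw [expNeg, EReal.coe_ennreal_ofReal, max_eq_left hr, ← EReal.coe_neg, EReal.exp_coe]

lemma expNeg_pos {x : ℝ≥0∞} (hx : x ≠ ∞) : 0 < expNeg x := by
  simpa using strictAnti_expNeg (lt_top_iff_ne_top.2 hx)

lemma expNeg_injective : Function.Injective expNeg := strictAnti_expNeg.injective

lemma expNeg_sum {ι : Type*} (s : Finset ι) (a : ι → ℝ≥0∞) :
    expNeg (∑ i ∈ s, a i) = ∏ i ∈ s, expNeg (a i) := by
  classical
  induction s using Finset.induction_on with
  | empty => simp
  | insert i s hi ih => rw [Finset.sum_insert hi, Finset.prod_insert hi, expNeg_add, ih]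

lemma expNeg_nat_mul (n : ℕ) (x : ℝ≥0∞) : expNeg (n * x) = expNeg x ^ n := by
  simpa using expNeg_sum (Finset.range n) (fun _ => x)

/-- The infinite product of a sequence in `[0, 1]`. -/
def infProd (g : ℕ → ℝ≥0∞) : ℝ≥0∞ := ⨅ k, ∏ i ∈ Finset.range k, g i

lemma antitone_prod_range {g : ℕ → ℝ≥0∞} (hg : ∀ i, g i ≤ 1) :
    Antitone fun k => ∏ i ∈ Finset.range k, g i :=
  antitone_nat_of_succ_le fun k => by
    rw [Finset.prod_range_succ]
    exact mul_le_of_le_one_right' (hg k)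

lemma tendsto_prod_infProd {g : ℕ → ℝ≥0∞} (hg : ∀ i, g i ≤ 1) :
    Tendsto (fun k => ∏ i ∈ Finset.range k, g i) atTop (𝓝 (infProd g)) :=
  tendsto_atTop_iInf (antitone_prod_range hg)

lemma infProd_expNeg (a : ℕ → ℝ≥0∞) :
    infProd (fun i => expNeg (a i)) = expNeg (∑' i, a i) := by
  refine tendsto_nhds_unique (tendsto_prod_infProd fun i => expNeg_le_one _) ?_
  simp_rw [← expNeg_sum]
  exact (continuous_expNeg.tendsto _).comp ENNReal.summable.hasSum.tendsto_sum_nat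

lemma infProd_eq_prod {g : ℕ → ℝ≥0∞} (hg : ∀ i, g i ≤ 1) (s : Finset ℕ)
    (hs : ∀ i ∉ s, g i = 1) : infProd g = ∏ i ∈ s, g i := by
  refine tendsto_nhds_unique (tendsto_prod_infProd hg) (tendsto_const_nhds.congr' ?_)
  filter_upwards [eventually_ge_atTop (s.sup id + 1)] with k hk
  refine Finset.prod_subset (fun i hi => ?_) (fun i _ hi => hs i hi)
  have := Finset.le_sup (f := id) hi
  simp only [id, Finset.mem_range] at *
  omega

lemma infProd_le_one (g : ℕ → ℝ≥0∞) : infProd g ≤ 1 :=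
  (iInf_le _ 0).trans (by simp)

lemma measurable_infProd {Ω : Type*} [MeasurableSpace Ω] {g : ℕ → Ω → ℝ≥0∞}
    (hg : ∀ i, Measurable (g i)) : Measurable fun ω => infProd fun i => g i ω :=
  Measurable.iInf fun _ => Finset.measurable_fun_prod _ fun i _ => hg i

/-- Monotone convergence for the decreasing partial products; it reduces statements about infinite
products to finite ones. -/
lemma lintegral_infProd {Ω : Type*} [MeasurableSpace Ω] (P : Measure Ω) [IsFiniteMeasure P]
    {g : ℕ → Ω → ℝ≥0∞} (hg : ∀ i, Measurable (g i)) (hg1 : ∀ i ω, g i ω ≤ 1) :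
    ∫⁻ ω, infProd (fun i => g i ω) ∂P = ⨅ k, ∫⁻ ω, ∏ i ∈ Finset.range k, g i ω ∂P := by
  unfold infProd
  refine lintegral_iInf (fun _ => Finset.measurable_fun_prod _ fun i _ => hg i) ?_ (by simp)
  exact fun _ _ hkl ω => antitone_prod_range (fun i => hg1 i ω) hkl

/-! ### Laplace functional of a (marked) Poisson point process. -/

section Counts

variable {Ω E : Type*} [MeasurableSpace Ω] [MeasurableSpace E]

lemma measurableSet_le_encard {p : ℕ → Ω → Prop} (hp : ∀ i, MeasurableSet {ω | p i ω}) (n : ℕ∞) :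
    MeasurableSet {ω | n ≤ {i | p i ω}.encard} := by
  have key (k : ℕ) : MeasurableSet {ω | (k : ℕ∞) ≤ {i | p i ω}.encard} := by
    have : {ω | (k : ℕ∞) ≤ {i | p i ω}.encard} =
        ⋃ F ∈ {F : Finset ℕ | F.card = k}, ⋂ i ∈ F, {ω | p i ω} := by
      ext ω
      simp only [mem_ofPred_eq, mem_iUnion, mem_iInter, exists_prop]
      constructor
      · intro h
        obtain ⟨t, ht, htk⟩ := exists_subset_encard_eq h
        have hfin : t.Finite := finite_of_encard_eq_coe htk
        refine ⟨hfin.toFinset, ?_, fun i hi => ht (by simpa using hi)⟩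
        rw [hfin.encard_eq_coe_toFinset_card] at htk
        exact_mod_cast htk
      · rintro ⟨F, hF, hFs⟩
        rw [← hF, ← encard_coe_eq_coe_finsetCard]
        exact encard_le_encard fun i hi => hFs i (by simpa using hi)
    rw [this]
    exact MeasurableSet.biUnion (to_countable _) fun F _ =>
      Finset.measurableSet_biInter _ fun i _ => hp i
  induction n with
  | coe k => exact key k
  | top =>
    have : {ω | ⊤ ≤ {i | p i ω}.encard} = ⋂ k : ℕ, {ω | (k : ℕ∞) ≤ {i | p i ω}.encard} := by
      ext ω
      simp only [mem_ofPred_eq, mem_iInter]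
      exact ⟨fun h k => le_top.trans h, fun h => (ENat.eq_top_iff_forall_ge.2 h).ge⟩
    rw [this]
    exact MeasurableSet.iInter key

lemma measurable_encard {p : ℕ → Ω → Prop} (hp : ∀ i, MeasurableSet {ω | p i ω}) :
    Measurable fun ω => {i | p i ω}.encard := by
  refine measurable_to_countable' fun n => ?_
  have : (fun ω => {i | p i ω}.encard) ⁻¹' {n} =
      {ω | n ≤ {i | p i ω}.encard} \ ⋃ m ∈ Ioi n, {ω | m ≤ {i | p i ω}.encard} := by
    ext ω
    simp only [mem_preimage, mem_singleton_iff, Set.mem_sdiff, mem_ofPred_eq, mem_iUnion, mem_Ioi,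
      exists_prop, not_exists, not_and, not_le]
    refine ⟨fun h => ⟨h.ge, fun m hm => h ▸ hm⟩, fun h => le_antisymm ?_ h.1⟩
    by_contra! hlt
    exact (h.2 _ hlt).false
  rw [this]
  exact (measurableSet_le_encard hp n).diff
    (MeasurableSet.biUnion (to_countable _) fun m _ => measurableSet_le_encard hp m)

/-- The probability generating function of the Poisson distribution. -/
lemma lintegral_pow_poissonMeasure (r : NNReal) {v : ℝ≥0∞} (hv : v ≤ 1) :
    ∫⁻ k, v ^ k ∂(poissonMeasure r) = expNeg ((1 - v) * r) := by
  lift v to NNReal using (hv.trans_lt ENNReal.one_lt_top).ne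
  have hv1 : (v : ℝ) ≤ 1 := by exact_mod_cast hv
  have h1 (n : ℕ) : ENNReal.ofReal (Real.exp (-r) * r ^ n / n.factorial) * (v : ℝ≥0∞) ^ n =
      ENNReal.ofReal (Real.exp (-r) * ((r * v : ℝ) ^ n / n.factorial)) := by
    rw [← ENNReal.ofReal_coe_nnreal, ← ENNReal.ofReal_pow (NNReal.coe_nonneg v),
      ← ENNReal.ofReal_mul (by positivity)]
    congr 1
    rw [mul_pow]
    ring
  have hs : HasSum (fun n : ℕ => Real.exp (-r) * ((r * v : ℝ) ^ n / n.factorial))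
      (Real.exp (-r) * Real.exp (r * v)) := by
    have := (NormedSpace.expSeries_div_hasSum_exp (r * v : ℝ)).mul_left (Real.exp (-r))
    rwa [← Real.exp_eq_exp_ℝ] at this
  have h2 : (1 - (v : ℝ≥0∞)) * r = ENNReal.ofReal ((1 - v) * r) := by
    rw [ENNReal.ofReal_mul (by linarith), ENNReal.ofReal_sub _ (NNReal.coe_nonneg v),
      ENNReal.ofReal_one, ENNReal.ofReal_coe_nnreal, ENNReal.ofReal_coe_nnreal]
  rw [poissonMeasure, lintegral_sum_measure]
  simp_rw [lintegral_smul_measure, lintegral_dirac, smul_eq_mul, h1]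
  rw [← ENNReal.ofReal_tsum_of_nonneg (fun n => by positivity) hs.summable, hs.tsum_eq, h2,
    expNeg_ofReal (mul_nonneg (by linarith) (NNReal.coe_nonneg r)), ← Real.exp_add]
  ring_nf

namespace IsPoissonPointProcess

variable {P : Measure Ω} {Λ : Measure E} {X : ℕ → Ω → E}

lemma measurable_count (hX : IsPoissonPointProcess P Λ X) {A : Set E} (hA : MeasurableSet A) :
    Measurable fun ω => {i : ℕ | X i ω ∈ A}.encard :=
  measurable_encard fun i => hX.measurable i hA

lemma ae_count_ne_top (hX : IsPoissonPointProcess P Λ X) {A : Set E} (hA : MeasurableSet A)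
    (hΛ : Λ A ≠ ∞) : ∀ᵐ ω ∂P, {i : ℕ | X i ω ∈ A}.encard ≠ ⊤ := by
  have h := congrArg (fun μ => μ {⊤}) (hX.poisson_count A hA hΛ)
  rw [Measure.map_apply (hX.measurable_count hA) (measurableSet_singleton _),
    Measure.map_apply .of_discrete (measurableSet_singleton _)] at h
  rw [ae_iff]
  simpa [preimage, Set.eq_empty_iff_forall_notMem] using h

lemma lintegral_pow_count (hX : IsPoissonPointProcess P Λ X) {A : Set E} (hA : MeasurableSet A)
    (hΛ : Λ A ≠ ∞) {v : ℝ≥0∞} (hv : v ≤ 1) :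
    ∫⁻ ω, v ^ {i : ℕ | X i ω ∈ A}.encard.toNat ∂P = expNeg ((1 - v) * Λ A) := by
  have h := congrArg (fun μ => ∫⁻ k, v ^ k.toNat ∂μ) (hX.poisson_count A hA hΛ)
  rw [lintegral_map .of_discrete (hX.measurable_count hA),
    lintegral_map .of_discrete .of_discrete] at h
  simp only [ENat.toNat_natCast] at h
  rw [h, lintegral_pow_poissonMeasure _ hv, ENNReal.coe_toNNReal hΛ]

/-- Grouping the points by the value of `f` turns the product into powers of `1 - c`, with
independent Poisson counts as exponents. The level `c = 0` contributes only factors 1, so its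
intensity may be infinite. -/
lemma lintegral_infProd_simpleFunc [IsProbabilityMeasure P] (hX : IsPoissonPointProcess P Λ X)
    (f : SimpleFunc E ℝ≥0∞) (hf : ∀ x, f x ≤ 1) (hΛ : ∀ c ≠ 0, Λ (f ⁻¹' {c}) ≠ ∞) :
    ∫⁻ ω, infProd (fun i => 1 - f (X i ω)) ∂P = expNeg (∫⁻ x, f x ∂Λ) := by
  classical
  set R := f.range.filter (· ≠ 0) with hR
  have hA (c : ℝ≥0∞) : MeasurableSet (f ⁻¹' {c}) := f.measurableSet_fiber c
  have hfin : ∀ᵐ ω ∂P, ∀ c ∈ R, {i : ℕ | X i ω ∈ f ⁻¹' {c}}.encard ≠ ⊤ := by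
    rw [Finset.eventually_all]
    exact fun c hc => hX.ae_count_ne_top (hA c) (hΛ c (Finset.mem_filter.1 hc).2)
  have hprod : ∀ᵐ ω ∂P, infProd (fun i => 1 - f (X i ω)) =
      ∏ c ∈ R, (1 - c) ^ {i : ℕ | X i ω ∈ f ⁻¹' {c}}.encard.toNat := by
    filter_upwards [hfin] with ω hω
    have hSfin : {i | f (X i ω) ≠ 0}.Finite := by
      have : {i | f (X i ω) ≠ 0} ⊆ ⋃ c ∈ R, {i : ℕ | X i ω ∈ f ⁻¹' {c}} := by
        intro i hi
        simp only [mem_iUnion, exists_prop]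
        exact ⟨f (X i ω), Finset.mem_filter.2 ⟨f.mem_range_self _, hi⟩, rfl⟩
      exact (R.finite_toSet.biUnion fun c hc => encard_ne_top_iff.1 (hω c hc)).subset this
    rw [infProd_eq_prod (fun i => tsub_le_self) hSfin.toFinset (fun i hi => by
      have : f (X i ω) = 0 := by simpa using hi
      simp [this])]
    rw [← Finset.prod_fiberwise_of_maps_to (t := R) (g := fun i => f (X i ω))
      (fun i hi => Finset.mem_filter.2 ⟨f.mem_range_self _, by simpa using hi⟩)]
    refine Finset.prod_congr rfl fun c hc => ?_
    rw [Finset.prod_congr rfl (g := fun _ => 1 - c) (fun i hi => by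
      rw [(Finset.mem_filter.1 hi).2]), Finset.prod_const]
    congr 1
    have hset : {i : ℕ | X i ω ∈ f ⁻¹' {c}} =
        ((hSfin.toFinset.filter fun i => f (X i ω) = c : Finset ℕ) : Set ℕ) := by
      ext i
      have := (Finset.mem_filter.1 hc).2
      simp only [mem_preimage, mem_singleton_iff, mem_ofPred_eq, Finset.coe_filter,
        Finite.mem_toFinset]
      exact ⟨fun h => ⟨h ▸ this, h⟩, fun h => h.2⟩
    rw [hset, encard_coe_eq_coe_finsetCard, ENat.toNat_natCast]
  rw [lintegral_congr_ae hprod]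
  let e := R.equivFin
  let A : Fin R.card → Set E := fun j => f ⁻¹' {(e.symm j : ℝ≥0∞)}
  have hind := hX.indep_count R.card A (fun j => hA _) (fun j k hjk => by
    refine Disjoint.preimage _ (disjoint_singleton.2 fun h => hjk ?_)
    exact e.symm.injective (Subtype.ext h))
  have hind' := hind.comp (fun j (k : ℕ∞) => (1 - (e.symm j : ℝ≥0∞)) ^ k.toNat)
    (fun j => .of_discrete)
  have hswap (F : ℝ≥0∞ → ℝ≥0∞) : ∏ c ∈ R, F c = ∏ j : Fin R.card, F (e.symm j) := by
    rw [← Finset.prod_coe_sort R, ← e.symm.prod_comp]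
  simp_rw [hswap]
  have := lintegral_prod_eq_prod_lintegral_of_indepFun Finset.univ _ hind'
    (fun j => Measurable.comp .of_discrete (hX.measurable_count (hA _)))
  simp only [Function.comp_def] at this
  rw [this, SimpleFunc.lintegral_eq_lintegral, SimpleFunc.lintegral]
  -- The level 0 contributes nothing to the integral, so both sides run over the same nonzero
  -- levels.
  rw [← Finset.sum_filter_of_ne (p := fun c => c ≠ 0) (fun c _ h hc => h (by simp [hc]))]
  rw [← hR, expNeg_sum, hswap]
  refine Finset.prod_congr rfl fun j _ => ?_
  rw [hX.lintegral_pow_count (hA _) (hΛ _ (Finset.mem_filter.1 (e.symm j).2).2) tsub_le_self,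
    ENNReal.sub_sub_cancel ENNReal.one_ne_top]
  obtain ⟨x, hx⟩ := SimpleFunc.mem_range.1 (Finset.mem_filter.1 (e.symm j).2).1
  exact hx ▸ hf x

/-- The Laplace functional of a Poisson point process, in multiplicative form. -/
lemma lintegral_infProd [IsProbabilityMeasure P] [SigmaFinite Λ]
    (hX : IsPoissonPointProcess P Λ X) {g : E → ℝ≥0∞} (hg : Measurable g) (hg1 : ∀ x, g x ≤ 1) :
    ∫⁻ ω, infProd (fun i => g (X i ω)) ∂P = expNeg (∫⁻ x, 1 - g x ∂Λ) := by
  have hfm : Measurable fun x => 1 - g x := measurable_const.sub hg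
  let S := spanningSets Λ
  have hS (m : ℕ) : MeasurableSet (S m) := measurableSet_spanningSets Λ m
  -- Restricting to sets of finite intensity makes every nonzero level set of the approximation
  -- finite in intensity.
  let f : ℕ → SimpleFunc E ℝ≥0∞ := fun m =>
    (SimpleFunc.eapprox (fun x => 1 - g x) m).restrict (S m)
  have hfapp (m : ℕ) (x : E) :
      f m x = (S m).indicator (SimpleFunc.eapprox (fun x => 1 - g x) m) x :=
    SimpleFunc.restrict_apply _ (hS m) x
  have hmono (x : E) : Monotone fun m => f m x := by
    intro m k hmk
    simp only [hfapp]
    exact (indicator_le_indicator_of_subset (monotone_spanningSets Λ hmk) (fun _ => zero_le) x).trans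
      (indicator_le_indicator (SimpleFunc.monotone_eapprox _ hmk x))
  have hlim (x : E) : Tendsto (fun m => f m x) atTop (𝓝 (1 - g x)) := by
    refine (SimpleFunc.tendsto_eapprox hfm x).congr' ?_
    filter_upwards [eventually_ge_atTop (spanningSetsIndex Λ x)] with m hm
    rw [hfapp, indicator_of_mem (mem_spanningSets_of_index_le Λ x hm)]
  have hle (m : ℕ) (x : E) : f m x ≤ 1 :=
    ((hmono x).ge_of_tendsto (hlim x) m).trans tsub_le_self
  have hfin (m : ℕ) (c : ℝ≥0∞) (hc : c ≠ 0) : Λ (f m ⁻¹' {c}) ≠ ∞ := by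
    rw [SimpleFunc.restrict_preimage_singleton _ (hS m) hc]
    exact ((measure_mono inter_subset_left).trans_lt (measure_spanningSets_lt_top Λ m)).ne
  have key (m : ℕ) := hX.lintegral_infProd_simpleFunc (f m) (hle m) (hfin m)
  have hR : Tendsto (fun m => expNeg (∫⁻ x, f m x ∂Λ)) atTop (𝓝 (expNeg (∫⁻ x, 1 - g x ∂Λ))) :=
    (continuous_expNeg.tendsto _).comp (lintegral_tendsto_of_tendsto_of_monotone
      (fun m => (f m).measurable.aemeasurable) (ae_of_all _ hmono) (ae_of_all _ hlim))
  have hmX (m i : ℕ) : Measurable fun ω => 1 - f m (X i ω) :=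
    measurable_const.sub ((f m).measurable.comp (hX.measurable i))
  have hL : Tendsto (fun m => ∫⁻ ω, infProd (fun i => 1 - f m (X i ω)) ∂P) atTop
      (𝓝 (∫⁻ ω, infProd (fun i => g (X i ω)) ∂P)) := by
    refine tendsto_lintegral_of_dominated_convergence (fun _ => 1)
      (fun m => measurable_infProd (hmX m)) (fun m => ae_of_all _ fun ω => infProd_le_one _)
      (by simp) (ae_of_all _ fun ω => ?_)
    -- The partial products decrease both in the number of factors and in `m`, so the two infima
    -- commute.
    have hswap : infProd (fun i => g (X i ω)) = ⨅ m, infProd (fun i => 1 - f m (X i ω)) := by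
      simp only [infProd]
      rw [iInf_comm]
      refine iInf_congr fun k => ?_
      refine tendsto_nhds_unique (f := fun m => ∏ i ∈ Finset.range k, (1 - f m (X i ω)))
        (l := atTop) ?_ (tendsto_atTop_iInf ?_)
      · refine ENNReal.tendsto_finsetProd_of_ne_top _ (fun i _ => ?_)
          fun i _ => ((hg1 _).trans_lt ENNReal.one_lt_top).ne
        have := ENNReal.Tendsto.sub (tendsto_const_nhds (x := (1 : ℝ≥0∞))) (hlim (X i ω))
          (Or.inl ENNReal.one_ne_top)
        rwa [ENNReal.sub_sub_cancel ENNReal.one_ne_top (hg1 _)] at this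
      · exact fun m l hml => Finset.prod_le_prod' fun i _ => tsub_le_tsub_left (hmono _ hml) _
    rw [hswap]
    refine tendsto_atTop_iInf fun m l hml => ?_
    exact iInf_mono fun k => Finset.prod_le_prod' fun i _ => tsub_le_tsub_left (hmono _ hml) _
  simp_rw [key] at hL
  exact tendsto_nhds_unique hL hR

/-- The Laplace functional of an independently marked Poisson point process, in multiplicative
form. -/
lemma lintegral_infProd_marked [IsProbabilityMeasure P] [SigmaFinite Λ]
    (hX : IsPoissonPointProcess P Λ X) {F : Type*} [MeasurableSpace F] {ν : Measure F}
    {h : ℕ → Ω → F} (h_meas : ∀ i, Measurable (h i)) (h_law : ∀ i, P.map (h i) = ν)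
    (h_indep : iIndepFun h P) (hX_indep : IndepFun (fun ω i => X i ω) (fun ω i => h i ω) P)
    {G : E → F → ℝ≥0∞} (hG : Measurable (Function.uncurry G)) (hG1 : ∀ x η, G x η ≤ 1) :
    ∫⁻ ω, infProd (fun i => G (X i ω) (h i ω)) ∂P = expNeg (∫⁻ x, ∫⁻ η, 1 - G x η ∂ν ∂Λ) := by
  have hν : IsProbabilityMeasure ν := h_law 0 ▸ Measure.isProbabilityMeasure_map
    (h_meas 0).aemeasurable
  have hXm := hX.measurable
  have hgm : Measurable fun x => ∫⁻ η, G x η ∂ν := hG.lintegral_prod_right'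
  have hg1 (x : E) : ∫⁻ η, G x η ∂ν ≤ 1 := by
    simpa using lintegral_mono (μ := ν) (hG1 x)
  have hsub (x : E) : ∫⁻ η, 1 - G x η ∂ν = 1 - ∫⁻ η, G x η ∂ν := by
    rw [lintegral_sub (show Measurable (G x) from hG.comp measurable_prodMk_left)
      ((hg1 x).trans_lt ENNReal.one_lt_top).ne (ae_of_all _ (hG1 x))]
    simp
  simp_rw [hsub]
  rw [← hX.lintegral_infProd hgm hg1,
    PoissonNetwork.lintegral_infProd P (g := fun i ω => G (X i ω) (h i ω))
      (fun i => hG.comp ((hXm i).prodMk (h_meas i))) (fun i ω => hG1 _ _),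
    PoissonNetwork.lintegral_infProd P (g := fun i ω => ∫⁻ η, G (X i ω) η ∂ν)
      (fun i => hgm.comp (hXm i)) (fun i ω => hg1 _)]
  refine iInf_congr fun k => ?_
  have hXX : Measurable fun ω i => X i ω := measurable_pi_lambda _ hXm
  have hhh : Measurable fun ω i => h i ω := measurable_pi_lambda _ h_meas
  -- Independence of positions and marks gives a product law: the positions can be frozen, and the
  -- independent marks then integrate factor by factor.
  have hprod : P.map (fun ω => (fun i => X i ω, fun i => h i ω)) =
      (P.map fun ω i => X i ω).prod (P.map fun ω i => h i ω) :=
    (indepFun_iff_map_prod_eq_prod_map_map hXX.aemeasurable hhh.aemeasurable).1 hX_indep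
  have hpm : Measurable fun p : (ℕ → E) × (ℕ → F) =>
      ∏ i ∈ Finset.range k, G (p.1 i) (p.2 i) :=
    Finset.measurable_fun_prod _ fun i _ =>
      hG.comp (g := Function.uncurry G)
        (f := fun p : (ℕ → E) × (ℕ → F) => (p.1 i, p.2 i)) (by fun_prop)
  have : IsProbabilityMeasure (P.map fun ω i => h i ω) :=
    Measure.isProbabilityMeasure_map hhh.aemeasurable
  have h1 := lintegral_map (μ := P) hpm (hXX.prodMk hhh)
  rw [hprod, lintegral_prod _ hpm.aemeasurable, lintegral_map hpm.lintegral_prod_right' hXX] at h1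
  simp only at h1
  rw [← h1]
  refine lintegral_congr fun ω => ?_
  rw [lintegral_map (f := fun y : ℕ → F => ∏ j ∈ Finset.range k, G (X j ω) (y j))
    (hpm.comp (measurable_prodMk_left (x := fun i => X i ω))) hhh]
  have h2 := lintegral_prod_eq_prod_lintegral_of_indepFun (Finset.range k) _
    (h_indep.comp (fun i η => G (X i ω) η) fun i => hG.comp measurable_prodMk_left)
    (fun i => (hG.comp measurable_prodMk_left).comp (h_meas i))
  simp only [Function.comp_def] at h2
  rw [h2]
  refine Finset.prod_congr rfl fun i _ => ?_
  rw [← h_law i, lintegral_map (f := G (X i ω)) (hG.comp measurable_prodMk_left) (h_meas i)]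

end IsPoissonPointProcess

end Counts

/-! ### The continued incomplete gamma function and `q`. -/

section Gamma

variable {a : ℝ}

lemma integrableOn_rpow_mul_exp_neg (b : ℝ) {y : ℝ} (hy : 0 < y) :
    IntegrableOn (fun t : ℝ => t ^ b * Real.exp (-t)) (Ioi y) := by
  refine integrable_of_isBigO_exp_neg (b := 1 / 2) (by norm_num) ?_ ?_
  · refine ContinuousOn.mul (fun t ht => ?_) (by fun_prop)
    exact (Real.continuousAt_rpow_const _ _ (Or.inl (hy.trans_le ht).ne')).continuousWithinAt
  · have h := Real.Gamma_integrand_isLittleO b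
    refine (h.isBigO.congr_left fun t => mul_comm _ _)

/-- Integration by parts reduces the continued incomplete gamma function to an integral. -/
lemma lowerGamma_neg (ha0 : 0 < a) (ha1 : a < 1) {y : ℝ} (hy : 0 < y) :
    lowerGamma (-a) y =
      -(1 / a) * (y ^ (-a) * Real.exp (-y) + ∫ t in (0)..y, t ^ (-a) * Real.exp (-t)) := by
  have hint : IntegrableOn (fun t : ℝ => t ^ (-a) * Real.exp (-t)) (Ioi 0) := by
    have := Real.GammaIntegral_convergent (s := 1 - a) (by linarith)
    refine this.congr_fun (fun t _ => ?_) measurableSet_Ioi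
    simp only [mul_comm, show 1 - a - 1 = -a by ring]
  have hG1 : Real.Gamma (1 - a) = ∫ t in Ioi (0 : ℝ), t ^ (-a) * Real.exp (-t) := by
    rw [Real.Gamma_eq_integral (by linarith)]
    simp only [mul_comm, show 1 - a - 1 = -a by ring]
  -- The functional equation is what gives meaning to `Γ(-a)` for `0 < a < 1`.
  have hG2 : Real.Gamma (1 - a) = -a * Real.Gamma (-a) := by
    rw [← Real.Gamma_add_one (by linarith)]
    ring_nf
  have hsplit := intervalIntegral.integral_Ioi_sub_Ioi hint hy.le
  have hderiv : ∀ t ∈ Ici y, HasDerivAt (fun t : ℝ => t ^ (-a) * Real.exp (-t))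
      (-a * (t ^ (-a - 1) * Real.exp (-t)) - t ^ (-a) * Real.exp (-t)) t := by
    intro t ht
    have h1 := Real.hasDerivAt_rpow_const (x := t) (p := -a) (Or.inl (hy.trans_le ht).ne')
    have h2 := (Real.hasDerivAt_exp (-t)).comp t (hasDerivAt_neg t)
    refine (h1.mul h2).congr_deriv ?_
    simp only [Function.comp_apply]
    ring
  have hi1 := integrableOn_rpow_mul_exp_neg (-a - 1) hy
  have hi2 := integrableOn_rpow_mul_exp_neg (-a) hy
  have hlim : Tendsto (fun t : ℝ => t ^ (-a) * Real.exp (-t)) atTop (𝓝 0) := by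
    simpa using (tendsto_rpow_neg_atTop ha0).mul (Real.tendsto_exp_neg_atTop_nhds_zero)
  have hparts := integral_Ioi_of_hasDerivAt_of_tendsto' hderiv ((hi1.const_mul (-a)).sub hi2) hlim
  rw [integral_sub (hi1.const_mul (-a)) hi2, integral_const_mul] at hparts
  have ha : a ≠ 0 := ha0.ne'
  rw [lowerGamma]
  field_simp
  linarith

lemma intervalIntegrable_rpow_neg_mul_exp_neg (ha1 : a < 1) (x y : ℝ) :
    IntervalIntegrable (fun t : ℝ => t ^ (-a) * Real.exp (-t)) volume x y :=
  (intervalIntegral.intervalIntegrable_rpow' (by linarith)).mul_continuousOn (by fun_prop)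

lemma hasDerivAt_lowerGamma_neg (ha0 : 0 < a) (ha1 : a < 1) {y : ℝ} (hy : 0 < y) :
    HasDerivAt (lowerGamma (-a)) (y ^ (-a - 1) * Real.exp (-y)) y := by
  have h1 := Real.hasDerivAt_rpow_const (x := y) (p := -a) (Or.inl hy.ne')
  have h2 := (Real.hasDerivAt_exp (-y)).comp y (hasDerivAt_neg y)
  have hcont : ∀ t : ℝ, 0 < t → ContinuousAt (fun t : ℝ => t ^ (-a) * Real.exp (-t)) t :=
    fun t ht => (Real.continuousAt_rpow_const _ _ (Or.inl ht.ne')).mul (by fun_prop)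
  have h3 : HasDerivAt (fun u => ∫ t in (0)..u, t ^ (-a) * Real.exp (-t))
      (y ^ (-a) * Real.exp (-y)) y := by
    refine intervalIntegral.integral_hasDerivAt_right
      (intervalIntegrable_rpow_neg_mul_exp_neg ha1 0 y) ?_ (hcont y hy)
    exact ContinuousAt.stronglyMeasurableAtFilter isOpen_Ioi hcont y hy
  have h4 := ((h1.mul h2).add h3).const_mul (-(1 / a))
  refine HasDerivAt.congr_deriv (h4.congr_of_eventuallyEq ?_) ?_
  · filter_upwards [lt_mem_nhds hy] with t ht
    exact lowerGamma_neg ha0 ha1 ht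
  · simp only [Function.comp_apply]
    field_simp
    ring

/-- The behaviour of `γ(-a, y)` as `y → 0`. -/
lemma tendsto_lowerGamma_neg_add (ha0 : 0 < a) (ha1 : a < 1) :
    Tendsto (fun y => lowerGamma (-a) y + 1 / a * y ^ (-a)) (𝓝[>] 0) (𝓝 0) := by
  have h1 : Tendsto (fun y => ∫ t in (0 : ℝ)..y, t ^ (-a) * Real.exp (-t)) (𝓝[>] 0) (𝓝 0) := by
    have := (intervalIntegral.continuous_primitive
      (intervalIntegrable_rpow_neg_mul_exp_neg ha1) 0).tendsto 0
    simp only [intervalIntegral.integral_same] at this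
    exact this.mono_left nhdsWithin_le_nhds
  -- The bound `0 ≤ 1 - e^(-y) ≤ y` squeezes the expression between 0 and `y^(1-a)`.
  have h2 : Tendsto (fun y : ℝ => y ^ (-a) * (1 - Real.exp (-y))) (𝓝[>] 0) (𝓝 0) := by
    have h0 : Tendsto (fun y : ℝ => y ^ (1 - a)) (𝓝[>] 0) (𝓝 0) := by
      have := (Real.continuousAt_rpow_const 0 (1 - a) (Or.inr (by linarith))).tendsto
      rw [Real.zero_rpow (by linarith)] at this
      exact this.mono_left nhdsWithin_le_nhds
    refine squeeze_zero' ?_ ?_ h0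
    · filter_upwards [self_mem_nhdsWithin] with y hy
      have : Real.exp (-y) ≤ 1 := Real.exp_le_one_iff.2 (by simpa using (mem_Ioi.1 hy).le)
      have := Real.rpow_nonneg (mem_Ioi.1 hy).le (-a)
      nlinarith
    · filter_upwards [self_mem_nhdsWithin] with y hy
      have := Real.add_one_le_exp (-y)
      have h3 := Real.rpow_nonneg (mem_Ioi.1 hy).le (-a)
      have h4 : y ^ (1 - a) = y ^ (-a) * y := by
        rw [← Real.rpow_add_one (mem_Ioi.1 hy).ne']
        ring_nf
      nlinarith
  have h5 := (h2.sub h1).const_mul (1 / a)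
  simp only [sub_zero, mul_zero] at h5
  refine h5.congr' ?_
  filter_upwards [self_mem_nhdsWithin] with y hy
  rw [lowerGamma_neg ha0 ha1 hy]
  ring

variable {α : ℝ}

/-- By the chain rule the gamma term contributes `-e^(-s/t) t^(2/α - 1)`, all powers of `s`
cancelling; the added power of `t` supplies the 1. -/
lemma hasDerivAt_q (hα : 2 < α) {t s : ℝ} (ht : 0 < t) (hs : 0 < s) :
    HasDerivAt (fun t => q α t s) ((1 - Real.exp (-(s / t))) * t ^ (2 / α - 1)) t := by
  have ha0 : 0 < 2 / α := by positivity
  have ha1 : 2 / α < 1 := (div_lt_one (by linarith)).2 hα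
  have h1 := hasDerivAt_lowerGamma_neg ha0 ha1 (div_pos hs ht)
  have h2 : HasDerivAt (fun t => s / t) (-(s / t ^ 2)) t := by
    simpa [div_eq_mul_inv, neg_mul] using (hasDerivAt_inv ht.ne').const_mul s
  have h3 := (h1.comp t h2).const_mul (s ^ (2 / α))
  have h4 := (Real.hasDerivAt_rpow_const (x := t) (p := 2 / α) (Or.inl ht.ne')).const_mul (α / 2)
  refine (h3.add h4).congr_deriv ?_
  have e1 : (s / t) ^ (-(2 / α) - 1) = s ^ (-(2 / α)) * s⁻¹ * (t ^ (2 / α) * t) := by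
    rw [Real.div_rpow hs.le ht.le, Real.rpow_sub_one hs.ne', Real.rpow_sub_one ht.ne',
      Real.rpow_neg ht.le]
    field_simp
  have e2 : s ^ (2 / α) * s ^ (-(2 / α)) = 1 := by
    rw [← Real.rpow_add hs]; simp
  have e3 : t ^ (2 / α - 1) = t ^ (2 / α) / t := Real.rpow_sub_one ht.ne' _
  rw [e1, e3]
  have hα0 : α ≠ 0 := by linarith
  calc _ = -(s ^ (2 / α) * s ^ (-(2 / α))) * (t ^ (2 / α) / t * Real.exp (-(s / t))) +
        t ^ (2 / α) / t := by
        field_simp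
    _ = _ := by rw [e2]; ring

/-- The term `(α/2) t^(2/α)` cancels exactly the singularity of `γ(-2/α, y)` at `y = s/t → 0`. -/
lemma tendsto_q_atTop (hα : 2 < α) {s : ℝ} (hs : 0 < s) :
    Tendsto (fun t => q α t s) atTop (𝓝 0) := by
  have ha0 : 0 < 2 / α := by positivity
  have ha1 : 2 / α < 1 := (div_lt_one (by linarith)).2 hα
  have h1 : Tendsto (fun t => s / t) atTop (𝓝[>] 0) := by
    refine tendsto_nhdsWithin_iff.2 ⟨tendsto_const_nhds.div_atTop tendsto_id, ?_⟩
    filter_upwards [eventually_gt_atTop 0] with t ht using div_pos hs ht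
  have h2 := ((tendsto_lowerGamma_neg_add ha0 ha1).comp h1).const_mul (s ^ (2 / α))
  rw [mul_zero] at h2
  refine h2.congr' ?_
  filter_upwards [eventually_gt_atTop 0] with t ht
  have e1 : (s / t) ^ (-(2 / α)) = s ^ (-(2 / α)) * t ^ (2 / α) := by
    rw [Real.div_rpow hs.le ht.le, Real.rpow_neg ht.le (2 / α), div_inv_eq_mul]
  have e2 : s ^ (2 / α) * s ^ (-(2 / α)) = 1 := by
    rw [← Real.rpow_add hs]; simp
  simp only [Function.comp_apply, q, e1, one_div_div]
  linear_combination (α / 2 * t ^ (2 / α)) * e2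

lemma one_sub_exp_mul_rpow_nonneg {s t : ℝ} (hs : 0 < s) (ht : 0 < t) (b : ℝ) :
    0 ≤ (1 - Real.exp (-(s / t))) * t ^ b := by
  refine mul_nonneg ?_ (Real.rpow_nonneg ht.le _)
  have : Real.exp (-(s / t)) ≤ 1 := Real.exp_le_one_iff.2 (by simpa using (div_pos hs ht).le)
  linarith

lemma q_nonpos (hα : 2 < α) {t s : ℝ} (ht : 0 < t) (hs : 0 < s) : q α t s ≤ 0 := by
  have := integral_Ioi_of_hasDerivAt_of_nonneg' (a := t)
    (fun x hx => hasDerivAt_q hα (ht.trans_le hx) hs)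
    (fun x hx => one_sub_exp_mul_rpow_nonneg hs (ht.trans hx) _) (tendsto_q_atTop hα hs)
  have h2 := setIntegral_nonneg (μ := volume) measurableSet_Ioi
    (fun x (hx : x ∈ Ioi t) => one_sub_exp_mul_rpow_nonneg hs (ht.trans hx) (2 / α - 1))
  linarith

/-- The fundamental theorem of calculus on a half-line. This is the integral in the exponent of the
Laplace functional, up to the factor `κ`. -/
lemma lintegral_one_sub_exp_mul_rpow (hα : 2 < α) {t s : ℝ} (ht : 0 < t) (hs : 0 < s) :
    ∫⁻ y in Ioi t, ENNReal.ofReal ((1 - Real.exp (-(s / y))) * y ^ (2 / α - 1)) =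
      ENNReal.ofReal (-q α t s) := by
  have hd : ∀ x ∈ Ici t, HasDerivAt (fun t => q α t s) _ x :=
    fun x hx => hasDerivAt_q hα (ht.trans_le hx) hs
  have hn : ∀ x ∈ Ioi t, 0 ≤ (1 - Real.exp (-(s / x))) * x ^ (2 / α - 1) :=
    fun x hx => one_sub_exp_mul_rpow_nonneg hs (ht.trans hx) _
  have h1 := integral_Ioi_of_hasDerivAt_of_nonneg' hd hn (tendsto_q_atTop hα hs)
  have h2 := integrableOn_Ioi_deriv_of_nonneg' hd hn (tendsto_q_atTop hα hs)
  rw [← ofReal_integral_eq_lintegral_ofReal h2 (ae_restrict_of_forall_mem measurableSet_Ioi hn),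
    h1, zero_sub]

lemma continuousAt_q_left (hα : 2 < α) {t s : ℝ} (ht : 0 < t) (hs : 0 < s) :
    ContinuousAt (fun t => q α t s) t :=
  (hasDerivAt_q hα ht hs).continuousAt

lemma continuousAt_q_right (hα : 2 < α) {t s : ℝ} (ht : 0 < t) (hs : 0 < s) :
    ContinuousAt (fun s => q α t s) s := by
  have ha0 : 0 < 2 / α := by positivity
  have ha1 : 2 / α < 1 := (div_lt_one (by linarith)).2 hα
  have h1 := (hasDerivAt_lowerGamma_neg ha0 ha1 (div_pos hs ht)).continuousAt
  have h2 : ContinuousAt (fun s => lowerGamma (-(2 / α)) (s / t)) s :=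
    ContinuousAt.comp (f := fun s => s / t) h1 (by fun_prop)
  exact ((Real.continuousAt_rpow_const _ _ (Or.inl hs.ne')).mul h2).add continuousAt_const

end Gamma

/-! ### Sector areas and the intensity on the power axis. -/

section Geometry

lemma polarAngle_eq (v : Plane) : polarAngle v =
    if 0 ≤ Complex.arg ⟨v 0, v 1⟩ then Complex.arg ⟨v 0, v 1⟩
    else Complex.arg ⟨v 0, v 1⟩ + 2 * Real.pi := by
  have h1 := Complex.neg_pi_lt_arg ⟨v 0, v 1⟩
  have h2 := Complex.arg_le_pi ⟨v 0, v 1⟩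
  have h3 := Real.pi_pos
  unfold polarAngle
  split_ifs with h
  · exact (toIcoMod_eq_self _).2 ⟨h, by linarith⟩
  · rw [← toIcoMod_add_right]
    exact (toIcoMod_eq_self _).2 ⟨by linarith, by linarith⟩

@[fun_prop]
lemma measurable_polarAngle : Measurable polarAngle := by
  have h1 : Measurable fun v : Plane => Complex.arg ⟨v 0, v 1⟩ := by
    refine Complex.measurable_arg.comp ?_
    exact Complex.measurableEquivRealProd.symm.measurable.comp
      (f := fun v : Plane => (v 0, v 1)) (by fun_prop)
  rw [funext polarAngle_eq]
  exact Measurable.ite (measurableSet_le measurable_const h1) h1 (h1.add_const _)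

/-- Principal arguments lie in `(-π, π]`, so for `φ ≥ π` the admissible angles wrap around to
negative arguments. -/
lemma volume_angles {φ : ℝ} (hφ0 : 0 < φ) (hφ1 : φ ≤ 2 * Real.pi) :
    volume {θ ∈ Ioo (-Real.pi) Real.pi | (if 0 ≤ θ then θ else θ + 2 * Real.pi) ≤ φ} =
      ENNReal.ofReal φ := by
  have hpi := Real.pi_pos
  rcases lt_or_ge φ Real.pi with h | h
  · have : {θ ∈ Ioo (-Real.pi) Real.pi | (if 0 ≤ θ then θ else θ + 2 * Real.pi) ≤ φ} =
        Icc 0 φ := by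
      ext θ
      simp only [mem_ofPred_eq, mem_Ioo, mem_Icc]
      split_ifs with hθ
      · exact ⟨fun h => ⟨hθ, h.2⟩, fun h' => ⟨⟨by linarith, by linarith⟩, h'.2⟩⟩
      · exact ⟨fun h => by linarith, fun h => by linarith⟩
    rw [this, Real.volume_Icc, sub_zero]
  -- Removing 0 matters only for `φ = 2π`, where it would otherwise belong to both pieces.
  · have : {θ ∈ Ioo (-Real.pi) Real.pi | (if 0 ≤ θ then θ else θ + 2 * Real.pi) ≤ φ} =
        Ico 0 Real.pi ∪ (Ioc (-Real.pi) (φ - 2 * Real.pi) \ {0}) := by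
      ext θ
      simp only [mem_ofPred_eq, mem_Ioo, mem_union, mem_Ico, mem_Ioc, Set.mem_sdiff,
        mem_singleton_iff]
      split_ifs with hθ
      · refine ⟨fun h => Or.inl ⟨hθ, h.1.2⟩, ?_⟩
        rintro (h' | h')
        · exact ⟨⟨by linarith, h'.2⟩, by linarith⟩
        · exact absurd (le_antisymm (by linarith) hθ) h'.2
      · refine ⟨fun h => Or.inr ⟨⟨h.1.1, by linarith⟩, fun h0 => hθ h0.ge⟩, ?_⟩
        rintro (h' | h')
        · exact absurd h'.1 hθ
        · exact ⟨⟨h'.1.1, by linarith⟩, by linarith⟩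
    rw [this, measure_union _ (measurableSet_Ioc.diff (measurableSet_singleton _)),
      measure_sdiff_null (by simp), Real.volume_Ico, Real.volume_Ioc,
      ← ENNReal.ofReal_add (by linarith) (by linarith)]
    · congr 1; ring
    · refine disjoint_left.2 fun θ h1 h2 => h2.2 ?_
      exact le_antisymm (by linarith [h2.1.2]) h1.1

/-- The area of a circular sector. -/
lemma volume_sector (x : Plane) {φ : ℝ} (hφ0 : 0 < φ) (hφ1 : φ ≤ 2 * Real.pi) {r : ℝ}
    (hr : 0 ≤ r) :
    volume {p : Plane | polarAngle (p - x) ≤ φ ∧ ‖p - x‖ ≤ r} = ENNReal.ofReal (φ / 2 * r ^ 2) := by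
  let T : ℝ → ℝ := fun θ => if 0 ≤ θ then θ else θ + 2 * Real.pi
  have hT : Measurable T :=
    Measurable.ite measurableSet_Ici measurable_id (measurable_id.add_const _)
  let S : Set ℂ := {w | T w.arg ≤ φ ∧ ‖w‖ ≤ r}
  have hS : MeasurableSet S :=
    (measurableSet_le (hT.comp Complex.measurable_arg) measurable_const).inter
      (measurableSet_le measurable_norm measurable_const)
  let e := Complex.orthonormalBasisOneI.repr.symm
  have he (v : Plane) : e v = ⟨v 0, v 1⟩ := by
    apply Complex.ext <;> simp [e, Complex.orthonormalBasisOneI]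
  have h1 : {p : Plane | polarAngle (p - x) ≤ φ ∧ ‖p - x‖ ≤ r} = (fun p => p - x) ⁻¹' (e ⁻¹' S) := by
    ext p
    simp only [mem_preimage, mem_ofPred_eq, S, e.norm_map, polarAngle_eq, T]
    rw [he]
  rw [h1, (measurePreserving_sub_right volume x).measure_preimage
      (e.measurePreserving.measurable hS).nullMeasurableSet,
    e.measurePreserving.measure_preimage hS.nullMeasurableSet, ← lintegral_indicator_one hS,
    ← Complex.lintegral_comp_polarCoord_symm]
  let A : Set ℝ := {θ ∈ Ioo (-Real.pi) Real.pi | T θ ≤ φ}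
  have hA : MeasurableSet A := measurableSet_Ioo.inter (measurableSet_le hT measurable_const)
  -- In polar coordinates the sector is the product of the radii `(0, r]` and the admissible
  -- arguments `A`, so the integral factors.
  have h2 : ∫⁻ p in polarCoord.target,
      ENNReal.ofReal p.1 • S.indicator 1 (Complex.polarCoord.symm p) =
      ∫⁻ p : ℝ × ℝ, (Ioc 0 r).indicator ENNReal.ofReal p.1 * A.indicator 1 p.2 := by
    rw [← lintegral_indicator polarCoord.open_target.measurableSet]
    refine lintegral_congr fun p => ?_
    by_cases hp : p ∈ polarCoord.target
    · rw [indicator_of_mem hp]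
      obtain ⟨hp1, hp2⟩ : 0 < p.1 ∧ p.2 ∈ Ioo (-Real.pi) Real.pi := by
        simpa [polarCoord_target] using hp
      have harg : (Complex.polarCoord.symm p).arg = p.2 := by
        rw [Complex.polarCoord_symm_apply]
        exact_mod_cast Complex.arg_mul_cos_add_sin_mul_I hp1 ⟨hp2.1, hp2.2.le⟩
      have hmem : Complex.polarCoord.symm p ∈ S ↔ T p.2 ≤ φ ∧ p.1 ≤ r := by
        simp only [S, mem_ofPred_eq, harg, Complex.norm_polarCoord_symm, abs_of_pos hp1]
      by_cases h3 : T p.2 ≤ φ <;> by_cases h4 : p.1 ≤ r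
      · rw [indicator_of_mem (hmem.2 ⟨h3, h4⟩), indicator_of_mem (show p.1 ∈ Ioc 0 r from ⟨hp1, h4⟩),
          indicator_of_mem (show p.2 ∈ A from ⟨hp2, h3⟩)]
        rfl
      · rw [indicator_of_notMem fun h => h4 (hmem.1 h).2,
          indicator_of_notMem fun h : p.1 ∈ Ioc 0 r => h4 h.2]
        simp
      · rw [indicator_of_notMem fun h => h3 (hmem.1 h).1,
          indicator_of_notMem fun h : p.2 ∈ A => h3 h.2]
        simp
      · rw [indicator_of_notMem fun h => h3 (hmem.1 h).1,
          indicator_of_notMem fun h : p.2 ∈ A => h3 h.2]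
        simp
    · rw [indicator_of_notMem hp]
      have : p.1 ∉ Ioc 0 r ∨ p.2 ∉ A := by
        by_contra! h
        exact hp (by simpa [polarCoord_target] using ⟨h.1.1, h.2.1.1, h.2.1.2⟩)
      rcases this with h | h <;> simp [indicator_of_notMem h]
  rw [h2, Measure.volume_eq_prod, lintegral_prod_mul
    (ENNReal.measurable_ofReal.indicator measurableSet_Ioc).aemeasurable
    (measurable_one.indicator hA).aemeasurable, lintegral_indicator_one hA,
    lintegral_indicator measurableSet_Ioc, volume_angles hφ0 hφ1,
    ← ofReal_integral_eq_lintegral_ofReal (f := fun y : ℝ => y)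
      ((intervalIntegrable_iff_integrableOn_Ioc_of_le hr).1 intervalIntegral.intervalIntegrable_id)
      (ae_restrict_of_forall_mem measurableSet_Ioc fun y hy => hy.1.le),
    ← intervalIntegral.integral_of_le hr, integral_id, zero_pow two_ne_zero,
    sub_zero, ← ENNReal.ofReal_mul (by positivity)]
  congr 1
  ring

/-- The intensity measure `κ y^(2/α - 1) dy` on `(0, ∞)`. -/
def powerIntensity (α κ : ℝ) : Measure ℝ :=
  (volume.restrict (Ioi 0)).withDensity fun y => ENNReal.ofReal (κ * y ^ (2 / α - 1))

variable {α κ : ℝ}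

lemma powerIntensity_Iic_zero : powerIntensity α κ (Iic 0) = 0 := by
  rw [powerIntensity, withDensity_apply _ measurableSet_Iic, Measure.restrict_restrict
    measurableSet_Iic, show Iic (0 : ℝ) ∩ Ioi 0 = ∅ by ext; simp]
  simp

lemma powerIntensity_Ioc (hα : 2 < α) (hκ : 0 ≤ κ) {a b : ℝ} (ha : 0 ≤ a) (hab : a ≤ b) :
    powerIntensity α κ (Ioc a b) =
      ENNReal.ofReal (κ * (α / 2) * b ^ (2 / α) - κ * (α / 2) * a ^ (2 / α)) := by
  have hb : -1 < 2 / α - 1 := by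
    have : 0 < 2 / α := by positivity
    linarith
  have hi : IntegrableOn (fun y : ℝ => κ * y ^ (2 / α - 1)) (Ioc a b) :=
    ((intervalIntegrable_iff_integrableOn_Ioc_of_le hab).1
      (intervalIntegral.intervalIntegrable_rpow' hb)).const_mul κ
  rw [powerIntensity, withDensity_apply _ measurableSet_Ioc,
    Measure.restrict_restrict measurableSet_Ioc,
    show Ioc a b ∩ Ioi 0 = Ioc a b from
      inter_eq_left.2 fun y hy => ha.trans_lt hy.1,
    ← ofReal_integral_eq_lintegral_ofReal hi (ae_restrict_of_forall_mem measurableSet_Ioc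
      fun y hy => mul_nonneg hκ (Real.rpow_nonneg (ha.trans hy.1.le) _)),
    ← intervalIntegral.integral_of_le hab, intervalIntegral.integral_const_mul,
    integral_rpow (Or.inl hb)]
  congr 1
  have : α ≠ 0 := by linarith
  rw [sub_add_cancel]
  field_simp

lemma powerIntensity_Iic (hα : 2 < α) (hκ : 0 ≤ κ) {t : ℝ} (ht : 0 ≤ t) :
    powerIntensity α κ (Iic t) = ENNReal.ofReal (κ * (α / 2) * t ^ (2 / α)) := by
  have h0 : (0 : ℝ) ^ (2 / α) = 0 := Real.zero_rpow (by positivity)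
  rw [← Iic_union_Ioc_eq_Iic ht, measure_union (Iic_disjoint_Ioc le_rfl) measurableSet_Ioc,
    powerIntensity_Iic_zero, powerIntensity_Ioc hα hκ le_rfl ht, h0]
  simp

/-- The inverse received powers of the interferers have intensity `κ y^(2/α - 1) dy`. -/
lemma map_inversePower (x : Plane) {lam φ : ℝ} (hlam : 0 < lam) (hα : 2 < α) (hφ0 : 0 < φ)
    (hφ1 : φ ≤ 2 * Real.pi) (ν : Measure ℝ) [IsProbabilityMeasure ν] (h_pos : ∀ᵐ t ∂ν, 0 < t)
    (h_mom : Integrable (fun t : ℝ => t ^ (2 / α)) ν) :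
    ((((ENNReal.ofReal lam • volume : Measure Plane).prod ν).restrict
      {p | polarAngle (p.1 - x) ≤ φ}).map fun p => ‖p.1 - x‖ ^ α / p.2) =
      powerIntensity α (φ * lam / α * ∫ t, t ^ (2 / α) ∂ν) := by
  set m := ∫ t, t ^ (2 / α) ∂ν with hm
  have hm0 : 0 ≤ m := integral_nonneg_of_ae (h_pos.mono fun t ht => Real.rpow_nonneg ht.le _)
  have hκ : 0 ≤ φ * lam / α * m := by positivity
  have hY : Measurable fun p : Plane × ℝ => ‖p.1 - x‖ ^ α / p.2 := by fun_prop
  have hC : MeasurableSet {p : Plane × ℝ | polarAngle (p.1 - x) ≤ φ} :=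
    measurableSet_le (by fun_prop) measurable_const
  have key (t : ℝ) : ((((ENNReal.ofReal lam • volume : Measure Plane).prod ν).restrict
      {p | polarAngle (p.1 - x) ≤ φ}).map fun p => ‖p.1 - x‖ ^ α / p.2) (Iic t) =
      powerIntensity α (φ * lam / α * m) (Iic t) := by
    have hB : MeasurableSet ((fun p : Plane × ℝ => ‖p.1 - x‖ ^ α / p.2) ⁻¹' Iic t ∩
        {p | polarAngle (p.1 - x) ≤ φ}) := (hY measurableSet_Iic).inter hC
    rw [Measure.map_apply hY measurableSet_Iic, Measure.restrict_apply (hY measurableSet_Iic),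
      Measure.prod_apply_symm hB]
    rcases lt_or_ge t 0 with ht | ht
    · rw [measure_mono_null (Iic_subset_Iic.2 ht.le) powerIntensity_Iic_zero, lintegral_eq_zero_iff'
        (measurable_measure_prodMk_right hB).aemeasurable]
      filter_upwards [h_pos] with η hη
      rw [show (fun p : Plane => (p, η)) ⁻¹' ((fun p : Plane × ℝ => ‖p.1 - x‖ ^ α / p.2) ⁻¹' Iic t ∩
        {p | polarAngle (p.1 - x) ≤ φ}) = ∅ from eq_empty_of_forall_notMem fun p hp => ?_]
      · simp
      · have h1 : ‖p - x‖ ^ α / η ≤ t := hp.1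
        have : 0 ≤ ‖p - x‖ ^ α / η := by positivity
        linarith
    · have hα0 : 0 < α := by linarith
      -- For a fixed gain `η` the section is a sector of radius `(t η)^(1/α)`; its area separates
      -- into a factor in `t` and the factor `η^(2/α)`.
      have hsec : ∀ᵐ η ∂ν, (ENNReal.ofReal lam • volume : Measure Plane) ((fun p : Plane => (p, η)) ⁻¹'
          ((fun p : Plane × ℝ => ‖p.1 - x‖ ^ α / p.2) ⁻¹' Iic t ∩
            {p | polarAngle (p.1 - x) ≤ φ})) =
          ENNReal.ofReal (lam * (φ / 2 * t ^ (2 / α))) * ENNReal.ofReal (η ^ (2 / α)) := by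
        filter_upwards [h_pos] with η hη
        have hset : (fun p : Plane => (p, η)) ⁻¹'
          ((fun p : Plane × ℝ => ‖p.1 - x‖ ^ α / p.2) ⁻¹' Iic t ∩
            {p | polarAngle (p.1 - x) ≤ φ}) =
            {p : Plane | polarAngle (p - x) ≤ φ ∧ ‖p - x‖ ≤ (t * η) ^ α⁻¹} := by
          ext p
          simp only [mem_preimage, mem_inter_iff, mem_Iic, mem_ofPred_eq]
          rw [and_comm, div_le_iff₀ hη, Real.le_rpow_inv_iff_of_pos (norm_nonneg _)
            (by positivity) hα0]
        rw [hset, Measure.smul_apply, volume_sector x hφ0 hφ1 (by positivity), smul_eq_mul,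
          ← ENNReal.ofReal_mul hlam.le, ← ENNReal.ofReal_mul (by positivity), ← Real.rpow_natCast,
          ← Real.rpow_mul (by positivity), Real.mul_rpow ht hη.le]
        congr 1
        push_cast
        rw [show α⁻¹ * 2 = 2 / α by ring]
        ring
      rw [lintegral_congr_ae hsec, lintegral_const_mul' _ _ ENNReal.ofReal_ne_top,
        ← ofReal_integral_eq_lintegral_ofReal h_mom
          (h_pos.mono fun t ht => Real.rpow_nonneg ht.le _), ← ENNReal.ofReal_mul (by positivity),
        powerIntensity_Iic hα hκ ht]
      congr 1
      rw [hm]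
      field_simp
  -- The half-lines form a generating π-system and those ending at natural numbers exhaust the line
  -- with finite mass.
  refine Measure.ext_of_generateFrom_of_iUnion (range Iic) (fun n : ℕ => Iic (n : ℝ))
    (borel_eq_generateFrom_Iic ℝ ▸ BorelSpace.measurable_eq) isPiSystem_Iic ?_
    (fun n => mem_range_self _) (fun n => ?_) ?_
  · refine eq_univ_of_forall fun y => mem_iUnion.2 ?_
    exact exists_nat_ge y
  · rw [key, powerIntensity_Iic hα hκ (Nat.cast_nonneg n)]
    exact ENNReal.ofReal_ne_top
  · rintro _ ⟨t, rfl⟩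
    exact key t

end Geometry

/-! ### Deterministic order statistics. -/

section OrderStatistics

/-- The `n`-th smallest of the values `Y i`, `i ∈ S`. -/
def orderStat (S : Set ℕ) (Y : ℕ → ℝ) (n : ℕ) : ℝ :=
  sInf {t : ℝ | (n : ℕ∞) ≤ {i ∈ S | Y i ≤ t}.encard}

/-- Infinitely many distinct values, finitely many below each level. -/
structure IsOrderable (S : Set ℕ) (Y : ℕ → ℝ) : Prop where
  infinite : S.Infinite
  injOn : InjOn Y S
  finite_le : ∀ t, {i ∈ S | Y i ≤ t}.Finite

namespace IsOrderable

variable {S : Set ℕ} {Y : ℕ → ℝ}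

lemma encard_mono (S : Set ℕ) (Y : ℕ → ℝ) {s t : ℝ} (hst : s ≤ t) :
    {i ∈ S | Y i ≤ s}.encard ≤ {i ∈ S | Y i ≤ t}.encard :=
  encard_le_encard fun _ hi => ⟨hi.1, hi.2.trans hst⟩

/-- The count of values up to `t` jumps only at values of `Y`, so the infimum is attained at one of
them. Distinct values make the jumps have size one, hence the count there is exactly `n`. -/
lemma exists_orderStat (H : IsOrderable S Y) {n : ℕ} (hn : 1 ≤ n) :
    ∃ i ∈ S, Y i = orderStat S Y n ∧ {j ∈ S | Y j ≤ Y i}.encard = n ∧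
      ∀ t, (n : ℕ∞) ≤ {j ∈ S | Y j ≤ t}.encard ↔ Y i ≤ t := by
  have hne {t : ℝ} (ht : (n : ℕ∞) ≤ {i ∈ S | Y i ≤ t}.encard) : {i ∈ S | Y i ≤ t}.Nonempty := by
    refine one_le_encard_iff_nonempty.1 (le_trans ?_ ht)
    exact_mod_cast hn
  have hmax {t : ℝ} (ht : (n : ℕ∞) ≤ {i ∈ S | Y i ≤ t}.encard) :
      ∃ j ∈ S, Y j ≤ t ∧ (n : ℕ∞) ≤ {i ∈ S | Y i ≤ Y j}.encard := by
    obtain ⟨j, hj, hjmax⟩ := exists_max_image _ Y (H.finite_le t) (hne ht)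
    exact ⟨j, hj.1, hj.2, ht.trans (encard_le_encard fun i hi => ⟨hi.1, hjmax i hi⟩)⟩
  obtain ⟨F, hFS, hFn⟩ := H.infinite.exists_subset_card_eq n
  obtain ⟨T, hT⟩ := (F.finite_toSet.image Y).bddAbove
  have hTn : (n : ℕ∞) ≤ {i ∈ S | Y i ≤ T}.encard := by
    rw [← hFn, ← encard_coe_eq_coe_finsetCard]
    exact encard_le_encard fun i hi => ⟨hFS hi, hT (mem_image_of_mem Y hi)⟩
  obtain ⟨j, hjS, hjT, hjn⟩ := hmax hTn
  obtain ⟨i, hi, himin⟩ := exists_min_image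
    {i ∈ {i ∈ S | Y i ≤ T} | (n : ℕ∞) ≤ {j ∈ S | Y j ≤ Y i}.encard} Y
    ((H.finite_le T).subset fun _ h => h.1) ⟨j, ⟨hjS, hjT⟩, hjn⟩
  have hiff (t : ℝ) : (n : ℕ∞) ≤ {j ∈ S | Y j ≤ t}.encard ↔ Y i ≤ t := by
    refine ⟨fun ht => ?_, fun ht => hi.2.trans (encard_mono S Y ht)⟩
    by_contra! hlt
    obtain ⟨k, hkS, hkt, hkn⟩ := hmax ht
    have := himin k ⟨⟨hkS, by linarith [hi.1.2]⟩, hkn⟩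
    linarith
  refine ⟨i, hi.1.1, ?_, le_antisymm ?_ hi.2, hiff⟩
  · have : {t : ℝ | (n : ℕ∞) ≤ {i ∈ S | Y i ≤ t}.encard} = Ici (Y i) := by
      ext t; exact hiff t
    rw [orderStat, this, csInf_Ici]
  -- With more than `n` values up to `Y i`, deleting `i` leaves at least `n`; the largest remaining
  -- one would then equal `Y i`, against injectivity.
  · by_contra! hlt
    have hmem : i ∈ {j ∈ S | Y j ≤ Y i} := ⟨hi.1.1, le_rfl⟩
    have hcard := encard_sdiff_singleton_add_one hmem
    have hle : (n : ℕ∞) ≤ ({j ∈ S | Y j ≤ Y i} \ {i}).encard := by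
      rw [← hcard] at hlt
      exact Order.le_of_lt_add_one hlt
    have hne' : ({j ∈ S | Y j ≤ Y i} \ {i}).Nonempty :=
      one_le_encard_iff_nonempty.1 (le_trans (by exact_mod_cast hn) hle)
    obtain ⟨k, hk, hkmax⟩ := exists_max_image _ Y ((H.finite_le (Y i)).subset sdiff_subset) hne'
    have h1 : Y i ≤ Y k := (hiff _).1
      (hle.trans (encard_le_encard fun l hl => ⟨hl.1.1, hkmax l hl⟩))
    exact hk.2 (H.injOn hk.1.1 hi.1.1 (le_antisymm hk.1.2 h1))

lemma orderStat_le_iff (H : IsOrderable S Y) {n : ℕ} (hn : 1 ≤ n) (t : ℝ) :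
    orderStat S Y n ≤ t ↔ (n : ℕ∞) ≤ {j ∈ S | Y j ≤ t}.encard := by
  obtain ⟨i, _, hi, _, h⟩ := H.exists_orderStat hn
  rw [h, hi]

lemma encard_le_orderStat (H : IsOrderable S Y) {n : ℕ} (hn : 1 ≤ n) :
    {j ∈ S | Y j ≤ orderStat S Y n}.encard = n := by
  obtain ⟨i, _, hi, h, _⟩ := H.exists_orderStat hn
  rw [← hi, h]

lemma orderStat_mem (H : IsOrderable S Y) {n : ℕ} (hn : 1 ≤ n) :
    ∃ i ∈ S, Y i = orderStat S Y n := by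
  obtain ⟨i, hiS, hi, _⟩ := H.exists_orderStat hn
  exact ⟨i, hiS, hi⟩

lemma orderStat_lt_iff (H : IsOrderable S Y) {m n : ℕ} (hm : 1 ≤ m) (hn : 1 ≤ n) :
    orderStat S Y m < orderStat S Y n ↔ m < n := by
  rw [← not_le, H.orderStat_le_iff hn, H.encard_le_orderStat hm, Nat.cast_le, not_le]

lemma strictMono_orderStat (H : IsOrderable S Y) :
    StrictMono fun k : ℕ => orderStat S Y (k + 1) := fun k l hkl =>
  (H.orderStat_lt_iff (by omega) (by omega)).2 (by omega)

/-- The rank of `i` is the finite number `n` of values up to `Y i`; the set below the `n`-th order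
statistic is contained in this one and has the same cardinality. -/
lemma exists_orderStat_eq (H : IsOrderable S Y) {i : ℕ} (hi : i ∈ S) :
    ∃ n, 1 ≤ n ∧ orderStat S Y n = Y i := by
  obtain ⟨n, hn⟩ := ENat.ne_top_iff_exists.1 (encard_ne_top_iff.2 (H.finite_le (Y i)))
  have hn1 : 1 ≤ n := by
    have : (1 : ℕ∞) ≤ {j ∈ S | Y j ≤ Y i}.encard :=
      one_le_encard_iff_nonempty.2 ⟨i, hi, le_rfl⟩
    rw [← hn] at this
    exact_mod_cast this
  have hle : orderStat S Y n ≤ Y i := (H.orderStat_le_iff hn1 _).2 hn.le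
  have hsub : {j ∈ S | Y j ≤ orderStat S Y n} ⊆ {j ∈ S | Y j ≤ Y i} :=
    fun _ hj => ⟨hj.1, hj.2.trans hle⟩
  have heq := ((H.finite_le (Y i)).subset hsub).eq_of_subset_of_encard_le hsub
    (by rw [H.encard_le_orderStat hn1, hn])
  have hmem : i ∈ {j ∈ S | Y j ≤ orderStat S Y n} := heq ▸ ⟨hi, le_rfl⟩
  exact ⟨n, hn1, le_antisymm hle hmem.2⟩

lemma range_orderStat (H : IsOrderable S Y) :
    range (fun k : ℕ => orderStat S Y (k + 1)) = Y '' S := by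
  ext y
  constructor
  · rintro ⟨k, rfl⟩
    exact H.orderStat_mem (by omega)
  · rintro ⟨i, hi, rfl⟩
    obtain ⟨n, hn, h⟩ := H.exists_orderStat_eq hi
    exact ⟨n - 1, by simp only [Nat.sub_add_cancel hn, h]⟩

/-- The later order statistics correspond bijectively to the labels with larger values. The sum over
labels is the form to which the Laplace functional applies. -/
lemma tsum_orderStat (H : IsOrderable S Y) {n : ℕ} (hn : 1 ≤ n) (F : ℝ → ℝ≥0∞) :
    ∑' k : ℕ, F (orderStat S Y (n + 1 + k)) =
      ∑' i, {i ∈ S | orderStat S Y n < Y i}.indicator (fun i => F (Y i)) i := by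
  choose g hgS hg using fun k : ℕ => H.orderStat_mem (n := n + 1 + k) (by omega)
  have hginj : Function.Injective g := fun k l hkl => by
    have h1 : orderStat S Y (n + 1 + k) = orderStat S Y (n + 1 + l) := by rw [← hg, ← hg, hkl]
    have h2 := H.orderStat_lt_iff (m := n + 1 + k) (n := n + 1 + l) (by omega) (by omega)
    have h3 := H.orderStat_lt_iff (m := n + 1 + l) (n := n + 1 + k) (by omega) (by omega)
    rw [h1] at h2 h3
    simp only [lt_self_iff_false, false_iff, not_lt] at h2 h3
    omega
  have hlt (k : ℕ) : orderStat S Y n < Y (g k) := by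
    rw [hg]
    exact (H.orderStat_lt_iff hn (by omega)).2 (by omega)
  rw [← hginj.tsum_eq (f := {i ∈ S | orderStat S Y n < Y i}.indicator fun i => F (Y i))]
  · refine tsum_congr fun k => ?_
    rw [indicator_of_mem (show g k ∈ {i ∈ S | orderStat S Y n < Y i} from ⟨hgS k, hlt k⟩), hg]
  · intro i hi
    have hi' : i ∈ {i ∈ S | orderStat S Y n < Y i} := by
      by_contra h
      exact hi (indicator_of_notMem h _)
    obtain ⟨m, hm, hmi⟩ := H.exists_orderStat_eq hi'.1
    have hnm : n < m := (H.orderStat_lt_iff hn hm).1 (hmi ▸ hi'.2)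
    refine ⟨m - (n + 1), H.injOn (hgS _) hi'.1 ?_⟩
    rw [hg, ← hmi]
    congr 1
    omega

end IsOrderable

end OrderStatistics

/-! ### Uniqueness of generating functions on `ℕ`. -/

section PowerSeries

/-- A step of the identification of the coefficients of a power series with nonnegative terms. -/
lemma coeff_le_of_tsum_mul_pow_le {a b : ℕ → ℝ≥0∞} (hb : ∑' k, b k ≠ ∞)
    (h : ∀ v : ℝ≥0∞, 0 < v → v < 1 → ∑' k, a k * v ^ k ≤ ∑' k, b k * v ^ k) {n : ℕ}
    (heq : ∀ k < n, a k = b k) : a n ≤ b n := by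
  have hbk (k : ℕ) : b k ≠ ∞ := ENNReal.ne_top_of_tsum_ne_top hb k
  -- Cancel the equal terms below `n`, bound the terms of `b` beyond `n` by `v^(n+1)` times the
  -- total mass, and divide by `v^n`; the error then vanishes as `v → 0`.
  have key (v : ℝ≥0∞) (hv0 : 0 < v) (hv1 : v < 1) : a n ≤ b n + v * ∑' k, b k := by
    have hvt : v ≠ ∞ := (hv1.trans ENNReal.one_lt_top).ne
    have h1 : ∑ k ∈ Finset.range n, b k * v ^ k + a n * v ^ n ≤
        ∑ k ∈ Finset.range n, b k * v ^ k + (b n + v * ∑' k, b k) * v ^ n := by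
      calc _ = ∑ k ∈ Finset.range (n + 1), a k * v ^ k := by
            rw [Finset.sum_range_succ]
            congr 1
            exact Finset.sum_congr rfl fun k hk => by rw [heq k (Finset.mem_range.1 hk)]
        _ ≤ ∑' k, a k * v ^ k := ENNReal.sum_le_tsum _
        _ ≤ ∑' k, b k * v ^ k := h v hv0 hv1
        _ = ∑ k ∈ Finset.range (n + 1), b k * v ^ k +
            ∑' k, b (k + (n + 1)) * v ^ (k + (n + 1)) :=
            (ENNReal.summable.sum_add_tsum_nat_add' (k := n + 1)).symm
        _ ≤ ∑ k ∈ Finset.range (n + 1), b k * v ^ k + (∑' k, b k) * (v * v ^ n) := by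
            gcongr
            rw [← ENNReal.tsum_mul_right]
            refine le_trans (ENNReal.tsum_le_tsum fun k => ?_) (ENNReal.tsum_comp_le_tsum_of_injective
              (add_left_injective (n + 1)) fun k => b k * (v * v ^ n))
            rw [← pow_succ']
            exact mul_le_mul' le_rfl (pow_le_pow_right_of_le_one' hv1.le (by omega))
        _ = _ := by rw [Finset.sum_range_succ]; ring
    have hfin : ∑ k ∈ Finset.range n, b k * v ^ k ≠ ∞ :=
      ENNReal.sum_ne_top.2 fun k _ => ENNReal.mul_ne_top (hbk k) (ENNReal.pow_ne_top hvt)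
    exact (ENNReal.mul_le_mul_iff_left (pow_ne_zero n hv0.ne') (ENNReal.pow_ne_top hvt)).1
      ((ENNReal.add_le_add_iff_left hfin).1 h1)
  have hlim : Tendsto (fun v : ℝ≥0∞ => b n + v * ∑' k, b k) (𝓝[>] 0) (𝓝 (b n)) := by
    have : Tendsto (fun v : ℝ≥0∞ => b n + v * ∑' k, b k) (𝓝 0) (𝓝 (b n + 0 * ∑' k, b k)) :=
      tendsto_const_nhds.add (ENNReal.Tendsto.mul_const tendsto_id (Or.inr hb))
    rw [zero_mul, add_zero] at this
    exact this.mono_left nhdsWithin_le_nhds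
  refine ge_of_tendsto hlim ?_
  filter_upwards [Ioo_mem_nhdsGT (zero_lt_one (α := ℝ≥0∞))] with v hv using key v hv.1 hv.2

/-- A finite measure on `ℕ` is determined by its generating function. -/
lemma measure_ext_of_lintegral_pow {μ ν : Measure ℕ} [IsFiniteMeasure μ] [IsFiniteMeasure ν]
    (h : ∀ v : ℝ≥0∞, 0 < v → v < 1 → ∫⁻ k, v ^ k ∂μ = ∫⁻ k, v ^ k ∂ν) : μ = ν := by
  have hsum (ρ : Measure ℕ) [IsFiniteMeasure ρ] : ∑' k, ρ {k} ≠ ∞ := by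
    have := lintegral_countable' (μ := ρ) (fun _ : ℕ => (1 : ℝ≥0∞))
    simp only [one_mul, lintegral_const] at this
    rw [← this]
    exact measure_ne_top _ _
  have h' (v : ℝ≥0∞) (h0 : 0 < v) (h1 : v < 1) :
      ∑' k, μ {k} * v ^ k = ∑' k, ν {k} * v ^ k := by
    simpa only [lintegral_countable', mul_comm] using h v h0 h1
  refine Measure.ext_of_singleton fun n => ?_
  induction n using Nat.strong_induction_on with
  | _ n ih =>
    exact le_antisymm
      (coeff_le_of_tsum_mul_pow_le (a := fun k => μ {k}) (b := fun k => ν {k}) (hsum ν)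
        (fun v h0 h1 => (h' v h0 h1).le) ih)
      (coeff_le_of_tsum_mul_pow_le (a := fun k => ν {k}) (b := fun k => μ {k}) (hsum μ)
        (fun v h0 h1 => (h' v h0 h1).ge) fun k hk => (ih k hk).symm)

end PowerSeries

lemma exists_expNeg_eq {v : ℝ≥0∞} (h0 : 0 < v) (h1 : v < 1) : ∃ u, u ≠ ∞ ∧ expNeg u = v := by
  have ht : v ≠ ∞ := (h1.trans ENNReal.one_lt_top).ne
  have hpos : 0 < v.toReal := ENNReal.toReal_pos h0.ne' ht
  have hlt : v.toReal ≤ 1 := ENNReal.toReal_mono ENNReal.one_ne_top h1.le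
  refine ⟨ENNReal.ofReal (-Real.log v.toReal), ENNReal.ofReal_ne_top, ?_⟩
  rw [expNeg_ofReal (neg_nonneg.2 (Real.log_nonpos hpos.le hlt)), neg_neg, Real.exp_log hpos,
    ENNReal.ofReal_toReal ht]

/-! ### Sums over points and consequences of the Laplace functional. -/

section PointSum

variable {Ω : Type*}

/-- The sum of `f` over the points `Y i ω` with label `i ∈ A ω`. -/
def pointSum (A : Ω → Set ℕ) (Y : ℕ → Ω → ℝ) (f : ℝ → ℝ≥0∞) (ω : Ω) : ℝ≥0∞ :=
  ∑' i, (A ω).indicator (fun i => f (Y i ω)) i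

/-- The number of points in `B` with label in `A ω`. -/
def pointCount (A : Ω → Set ℕ) (Y : ℕ → Ω → ℝ) (B : Set ℝ) (ω : Ω) : ℕ∞ :=
  {i | i ∈ A ω ∧ Y i ω ∈ B}.encard

lemma pointSum_const_indicator (A : Ω → Set ℕ) (Y : ℕ → Ω → ℝ) (B : Set ℝ) (u : ℝ≥0∞) (ω : Ω) :
    pointSum A Y (B.indicator fun _ => u) ω = pointCount A Y B ω * u := by
  rw [pointCount, ← ENNReal.tsum_set_const, tsum_subtype _ fun _ => u, pointSum]
  refine tsum_congr fun i => ?_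
  by_cases h1 : i ∈ A ω <;> by_cases h2 : Y i ω ∈ B <;> simp [indicator, h1, h2]

lemma pointSum_add (A : Ω → Set ℕ) (Y : ℕ → Ω → ℝ) (f g : ℝ → ℝ≥0∞) (ω : Ω) :
    pointSum A Y (fun y => f y + g y) ω = pointSum A Y f ω + pointSum A Y g ω := by
  rw [pointSum, pointSum, pointSum, ← ENNReal.tsum_add]
  exact tsum_congr fun i => congrFun (indicator_add (A ω) _ _) i

lemma pointSum_const_mul (A : Ω → Set ℕ) (Y : ℕ → Ω → ℝ) (c : ℝ≥0∞) (f : ℝ → ℝ≥0∞) (ω : Ω) :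
    pointSum A Y (fun y => c * f y) ω = c * pointSum A Y f ω := by
  rw [pointSum, pointSum, ← ENNReal.tsum_mul_left]
  exact tsum_congr fun i => by simp only [indicator, mul_ite, mul_zero]

variable [MeasurableSpace Ω]

/-- The points `Y i ω`, `i ∈ A ω`, have the Laplace functional of a Poisson process with intensity
measure `M`. -/
structure HasPoissonLaplace (P : Measure Ω) (M : Measure ℝ) (A : Ω → Set ℕ) (Y : ℕ → Ω → ℝ) :
    Prop where
  measurableSet_mem : ∀ i, MeasurableSet {ω | i ∈ A ω}
  measurable : ∀ i, Measurable (Y i)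
  laplace : ∀ f : ℝ → ℝ≥0∞, Measurable f →
    ∫⁻ ω, expNeg (pointSum A Y f ω) ∂P = expNeg (∫⁻ y, 1 - expNeg (f y) ∂M)

namespace HasPoissonLaplace

variable {P : Measure Ω} {M : Measure ℝ} {A : Ω → Set ℕ} {Y : ℕ → Ω → ℝ}

/-- The function summed may depend on a random parameter; this is needed for the tail beyond a
random level. -/
lemma measurable_pointSum_comp (H : HasPoissonLaplace P M A Y) {β : Type*} [MeasurableSpace β]
    {f : β → ℝ → ℝ≥0∞} (hf : Measurable (Function.uncurry f)) {b : Ω → β} (hb : Measurable b) :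
    Measurable fun ω => pointSum A Y (f (b ω)) ω := by
  refine Measurable.tsum fun i => ?_
  have : (fun ω => (A ω).indicator (fun i => f (b ω) (Y i ω)) i) =
      {ω | i ∈ A ω}.indicator fun ω => f (b ω) (Y i ω) := by
    ext ω; simp only [indicator, mem_ofPred_eq]
  rw [this]
  exact (hf.comp (hb.prodMk (H.measurable i))).indicator (H.measurableSet_mem i)

lemma measurable_pointSum (H : HasPoissonLaplace P M A Y) {f : ℝ → ℝ≥0∞} (hf : Measurable f) :
    Measurable (pointSum A Y f) :=
  H.measurable_pointSum_comp (f := fun _ : Unit => f) (hf.comp measurable_snd)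
    (measurable_const (a := ()))

lemma measurable_pointCount (H : HasPoissonLaplace P M A Y) {B : Set ℝ} (hB : MeasurableSet B) :
    Measurable (pointCount A Y B) :=
  measurable_encard fun i => (H.measurableSet_mem i).inter (H.measurable i hB)

lemma measurable_expNeg_count (H : HasPoissonLaplace P M A Y) {B : Set ℝ} (hB : MeasurableSet B)
    (u : ℝ≥0∞) : Measurable fun ω => expNeg (pointCount A Y B ω * u) :=
  measurable_expNeg.comp (((measurable_of_countable fun k : ℕ∞ => (k : ℝ≥0∞)).comp
    (H.measurable_pointCount hB)).mul_const u)

lemma lintegral_one_sub_expNeg_indicator {B : Set ℝ} (hB : MeasurableSet B) (u : ℝ≥0∞) :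
    ∫⁻ y, 1 - expNeg (B.indicator (fun _ => u) y) ∂M = (1 - expNeg u) * M B := by
  rw [← lintegral_indicator_const hB]
  refine lintegral_congr fun y => ?_
  by_cases h : y ∈ B <;> simp [h]

lemma laplace_count (H : HasPoissonLaplace P M A Y) {B : Set ℝ} (hB : MeasurableSet B)
    (u : ℝ≥0∞) :
    ∫⁻ ω, expNeg (pointCount A Y B ω * u) ∂P = expNeg ((1 - expNeg u) * M B) := by
  rw [← lintegral_one_sub_expNeg_indicator hB, ← H.laplace _ (measurable_const.indicator hB)]
  simp_rw [pointSum_const_indicator]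

/-- For a sum `S` and constants `c m → 0`, `E[e^(-c m S)] ≤ P(S < ∞)`, and the left side tends to 1
by dominated convergence in the exponent. -/
lemma ae_pointSum_ne_top [IsProbabilityMeasure P] (H : HasPoissonLaplace P M A Y)
    {f : ℝ → ℝ≥0∞} (hf : Measurable f) (hft : ∀ y, f y ≠ ∞)
    (hM : ∫⁻ y, 1 - expNeg (f y) ∂M ≠ ∞) : ∀ᵐ ω ∂P, pointSum A Y f ω ≠ ∞ := by
  have hS := H.measurable_pointSum hf
  have hset : MeasurableSet {ω | pointSum A Y f ω ≠ ∞} :=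
    (hS (measurableSet_singleton ∞)).compl
  let c : ℕ → ℝ≥0∞ := fun m => ((m : ℝ≥0∞) + 1)⁻¹
  have hc1 (m : ℕ) : c m ≤ 1 := ENNReal.inv_le_one.2 le_add_self
  have hc0 (m : ℕ) : c m ≠ 0 := ENNReal.inv_ne_zero.2 (by finiteness)
  have hclim : Tendsto c atTop (𝓝 0) := by
    have := (tendsto_add_atTop_iff_nat 1).2 ENNReal.tendsto_inv_nat_nhds_zero
    simpa [c] using this
  have hle (m : ℕ) : expNeg (∫⁻ y, 1 - expNeg (c m * f y) ∂M) ≤ P {ω | pointSum A Y f ω ≠ ∞} := by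
    rw [← H.laplace _ (hf.const_mul _), ← lintegral_indicator_one hset]
    refine lintegral_mono fun ω => ?_
    by_cases h : pointSum A Y f ω = ∞
    · simp [pointSum_const_mul, h, ENNReal.mul_top (hc0 m)]
    · rw [indicator_of_mem (by exact h)]
      exact expNeg_le_one _
  have hlim : Tendsto (fun m => expNeg (∫⁻ y, 1 - expNeg (c m * f y) ∂M)) atTop (𝓝 1) := by
    have h0 : expNeg (∫⁻ _, 0 ∂M) = 1 := by simp
    suffices hs : Tendsto (fun m => ∫⁻ y, 1 - expNeg (c m * f y) ∂M) atTop (𝓝 (∫⁻ _, 0 ∂M)) by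
      have := (continuous_expNeg.tendsto _).comp hs
      rwa [h0] at this
    refine tendsto_lintegral_of_dominated_convergence
      (fun y => 1 - expNeg (f y)) (fun m => by fun_prop) (fun m => ae_of_all _ fun y => ?_) hM
      (ae_of_all _ fun y => ?_)
    · exact tsub_le_tsub_left (antitone_expNeg (mul_le_of_le_one_left' (hc1 m))) _
    · have h1 : Tendsto (fun m => c m * f y) atTop (𝓝 0) := by
        simpa using ENNReal.Tendsto.mul_const hclim (Or.inr (hft y))
      have h2 := (continuous_expNeg.tendsto 0).comp h1
      rw [expNeg_zero] at h2
      simpa using ENNReal.Tendsto.sub (tendsto_const_nhds (x := (1 : ℝ≥0∞))) h2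
        (Or.inl ENNReal.one_ne_top)
  have h1 : 1 ≤ P {ω | pointSum A Y f ω ≠ ∞} := le_of_tendsto' hlim hle
  exact (mem_ae_iff_prob_eq_one hset).2 (le_antisymm prob_le_one h1)

lemma ae_pointCount_ne_top [IsProbabilityMeasure P] (H : HasPoissonLaplace P M A Y)
    {B : Set ℝ} (hB : MeasurableSet B) (hM : M B ≠ ∞) : ∀ᵐ ω ∂P, pointCount A Y B ω ≠ ⊤ := by
  have := H.ae_pointSum_ne_top (measurable_const.indicator hB) (f := B.indicator fun _ => 1)
    (fun y => by by_cases h : y ∈ B <;> simp [h])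
    (by rw [lintegral_one_sub_expNeg_indicator hB]; exact ENNReal.mul_ne_top (by finiteness) hM)
  filter_upwards [this] with ω hω
  simpa [pointSum_const_indicator] using hω

/-- The Laplace transform of the count at 1 is `e^(-∞) = 0`, which forces the nonnegative integrand
to vanish. -/
lemma ae_pointCount_eq_top (H : HasPoissonLaplace P M A Y)
    {B : Set ℝ} (hB : MeasurableSet B) (hM : M B = ∞) : ∀ᵐ ω ∂P, pointCount A Y B ω = ⊤ := by
  have h2 := H.laplace_count hB 1
  have h3 : (1 - expNeg 1) * M B = ∞ := by
    rw [hM, ENNReal.mul_top]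
    have : expNeg 1 < 1 := by simpa using strictAnti_expNeg (zero_lt_one (α := ℝ≥0∞))
    exact (tsub_pos_of_lt this).ne'
  rw [h3, expNeg_top, lintegral_eq_zero_iff (H.measurable_expNeg_count hB 1)] at h2
  filter_upwards [h2] with ω hω
  by_contra hne
  have := expNeg_pos (x := pointCount A Y B ω * 1) (by simpa using hne)
  exact this.ne' hω

lemma ae_pointCount_eq_zero [IsProbabilityMeasure P] (H : HasPoissonLaplace P M A Y)
    {B : Set ℝ} (hB : MeasurableSet B) (hM : M B = 0) : ∀ᵐ ω ∂P, pointCount A Y B ω = 0 := by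
  have hm := H.measurable_expNeg_count hB 1
  have h1 := H.laplace_count hB 1
  rw [hM, mul_zero, expNeg_zero] at h1
  have h2 : ∫⁻ ω, 1 - expNeg (pointCount A Y B ω * 1) ∂P = 0 := by
    rw [lintegral_sub hm (by rw [h1]; exact ENNReal.one_ne_top)
      (ae_of_all _ fun ω => expNeg_le_one _), h1]
    simp
  rw [lintegral_eq_zero_iff (by fun_prop)] at h2
  filter_upwards [h2] with ω hω
  have h3 : expNeg (pointCount A Y B ω * 1) = expNeg 0 := by
    rw [expNeg_zero]
    exact le_antisymm (expNeg_le_one _) (tsub_eq_zero_iff_le.1 hω)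
  simpa using expNeg_injective h3

end HasPoissonLaplace

end PointSum

/-! ### Independence over disjoint regions and rarity of double points. -/

section Independence

variable {Ω : Type*} [MeasurableSpace Ω] {P : Measure Ω} {M : Measure ℝ} {A : Ω → Set ℕ}
  {Y : ℕ → Ω → ℝ}

namespace HasPoissonLaplace

/-- Sums over disjoint regions are independent, in terms of Laplace transforms. -/
lemma laplace_add (H : HasPoissonLaplace P M A Y) {f g : ℝ → ℝ≥0∞} (hf : Measurable f)
    (hg : Measurable g) (hfg : ∀ y, f y = 0 ∨ g y = 0) :
    ∫⁻ ω, expNeg (pointSum A Y f ω) * expNeg (pointSum A Y g ω) ∂P =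
      (∫⁻ ω, expNeg (pointSum A Y f ω) ∂P) * ∫⁻ ω, expNeg (pointSum A Y g ω) ∂P := by
  simp_rw [← expNeg_add, ← pointSum_add]
  rw [H.laplace (fun y => f y + g y) (hf.add hg), H.laplace _ hf, H.laplace _ hg, ← expNeg_add,
    ← lintegral_add_left (by fun_prop)]
  congr 1
  -- Where one of `f`, `g` vanishes, `1 - e^(-(f+g))` is the sum of the two separate terms.
  refine lintegral_congr fun y => ?_
  rcases hfg y with h | h <;> simp [h]

/-- The number of points in `B` is independent of a sum over the complement of `B`. -/
lemma setLIntegral_expNeg_pointSum [IsProbabilityMeasure P] (H : HasPoissonLaplace P M A Y)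
    {B : Set ℝ} (hB : MeasurableSet B) (hM : M B ≠ ∞) {f : ℝ → ℝ≥0∞} (hf : Measurable f)
    (hfB : ∀ y ∈ B, f y = 0) (n : ℕ) :
    ∫⁻ ω in {ω | (n : ℕ∞) ≤ pointCount A Y B ω}, expNeg (pointSum A Y f ω) ∂P =
      (∫⁻ ω, expNeg (pointSum A Y f ω) ∂P) * P {ω | (n : ℕ∞) ≤ pointCount A Y B ω} := by
  set D : Ω → ℝ≥0∞ := fun ω => expNeg (pointSum A Y f ω) with hD
  have hDm : Measurable D := measurable_expNeg.comp (H.measurable_pointSum hf)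
  have hNm := H.measurable_pointCount hB
  set N : Ω → ℕ := fun ω => (pointCount A Y B ω).toNat with hN
  have hNm' : Measurable N := Measurable.comp (.of_discrete (f := ENat.toNat)) hNm
  have hfin := H.ae_pointCount_ne_top hB hM
  have hL1 : ∫⁻ ω, D ω ∂P ≤ 1 := by
    simpa using lintegral_mono (μ := P) fun ω => expNeg_le_one (pointSum A Y f ω)
  have hLt : ∫⁻ ω, D ω ∂P ≠ ∞ := (hL1.trans_lt ENNReal.one_lt_top).ne
  have : IsFiniteMeasure (P.withDensity D) := isFiniteMeasure_withDensity hLt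
  have : IsFiniteMeasure ((∫⁻ ω, D ω ∂P) • P.map N) := Measure.smul_finite _ hLt
  have hpow (u : ℝ≥0∞) : ∀ᵐ ω ∂P, expNeg u ^ N ω =
      expNeg (pointSum A Y (B.indicator fun _ => u) ω) := by
    filter_upwards [hfin] with ω hω
    rw [pointSum_const_indicator, ← expNeg_nat_mul, ← ENat.natCast_toNat hω]
    rfl
  -- Both finite measures on `ℕ` have the same generating function, by the product formula for
  -- disjoint supports.
  have hmeas : (P.withDensity D).map N = (∫⁻ ω, D ω ∂P) • P.map N := by
    refine measure_ext_of_lintegral_pow fun v h0 h1 => ?_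
    obtain ⟨u, -, rfl⟩ := exists_expNeg_eq h0 h1
    rw [lintegral_map .of_discrete hNm', lintegral_smul_measure,
      lintegral_map .of_discrete hNm', smul_eq_mul,
      lintegral_withDensity_eq_lintegral_mul (g := fun ω => expNeg u ^ N ω) _ hDm
        (measurable_const.pow hNm')]
    rw [lintegral_congr_ae (hpow u), ← H.laplace_add hf (measurable_const.indicator hB) fun y => ?_]
    · refine lintegral_congr_ae ?_
      filter_upwards [hpow u] with ω hω
      simp only [Pi.mul_apply, hω, hD]
    · by_cases h : y ∈ B
      · exact Or.inl (hfB y h)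
      · exact Or.inr (indicator_of_notMem h _)
  have hset : {ω | (n : ℕ∞) ≤ pointCount A Y B ω} =ᵐ[P] N ⁻¹' Ici n := by
    filter_upwards [hfin] with ω hω
    refine propext ?_
    change (n : ℕ∞) ≤ pointCount A Y B ω ↔ n ≤ (pointCount A Y B ω).toNat
    conv_lhs => rw [← ENat.natCast_toNat hω]
    exact Nat.cast_le
  have h := congrArg (fun μ => μ (Ici n)) hmeas
  simp only [Measure.map_apply hNm' measurableSet_Ici, Measure.smul_apply, smul_eq_mul,
    withDensity_apply _ (hNm' measurableSet_Ici)] at h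
  rw [setLIntegral_congr hset, measure_congr hset, h]

/-- The probability of seeing two points in a set is quadratically small in its intensity. -/
lemma measure_two_le_pointCount_le [IsProbabilityMeasure P] (H : HasPoissonLaplace P M A Y)
    {B : Set ℝ} (hB : MeasurableSet B) {μ : ℝ} (hμ : 0 ≤ μ) (hM : M B = ENNReal.ofReal μ) :
    P {ω | 2 ≤ pointCount A Y B ω} ≤ ENNReal.ofReal (3 * μ ^ 2) := by
  -- With this `c`, a count `k` gives `e^(-kc) = 2^(-k)`.
  set c : ℝ≥0∞ := ENNReal.ofReal (Real.log 2) with hc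
  have hexp1 : expNeg c = ENNReal.ofReal (1 / 2) := by
    rw [hc, expNeg_ofReal (Real.log_nonneg (by norm_num)), Real.exp_neg, Real.exp_log two_pos]
    norm_num
  have hexp2 : expNeg (c + c) = ENNReal.ofReal (1 / 4) := by
    rw [expNeg_add, hexp1, ← ENNReal.ofReal_mul (by norm_num)]
    norm_num
  have hsub {r : ℝ} (hr0 : 0 ≤ r) (hr1 : r ≤ 1) : (1 - ENNReal.ofReal r) * M B =
      ENNReal.ofReal ((1 - r) * μ) := by
    rw [hM, ← ENNReal.ofReal_one, ← ENNReal.ofReal_sub _ hr0, ← ENNReal.ofReal_mul (by linarith)]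
  have h1 := H.laplace_count hB c
  have h2 := H.laplace_count hB (c + c)
  rw [hexp1, hsub (by norm_num) (by norm_num), expNeg_ofReal (by linarith)] at h1
  rw [hexp2, hsub (by norm_num) (by norm_num), expNeg_ofReal (by linarith)] at h2
  have hset : MeasurableSet {ω | 2 ≤ pointCount A Y B ω} :=
    H.measurable_pointCount hB (MeasurableSet.of_discrete (s := Ici (2 : ℕ∞)))
  -- For `w = 2^(-k)` this reads `(1 - w)(1/2 - w) ≥ (3/16) 1_{k ≥ 2}`: the left side vanishes at `k
  -- = 0, 1` and is at least `(3/4)(1/4)` for `w ≤ 1/4`.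
  have hpt (ω : Ω) : {ω | 2 ≤ pointCount A Y B ω}.indicator (fun _ => ENNReal.ofReal (3 / 16)) ω +
      ENNReal.ofReal (3 / 2) * expNeg (pointCount A Y B ω * c) ≤
      ENNReal.ofReal (1 / 2) + expNeg (pointCount A Y B ω * (c + c)) := by
    by_cases htop : pointCount A Y B ω = ⊤
    · have hc0 : c ≠ 0 := by simp [hc, Real.log_pos]
      rw [indicator_of_mem (by simp [htop]), htop]
      simp only [ENat.toENNReal_top, ENNReal.top_mul hc0,
        ENNReal.top_mul (add_pos_of_pos_of_nonneg (pos_iff_ne_zero.2 hc0) zero_le).ne', expNeg_top,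
        mul_zero, add_zero]
      exact ENNReal.ofReal_le_ofReal (by norm_num)
    · obtain ⟨k, hk⟩ := ENat.ne_top_iff_exists.1 htop
      have hw : expNeg (pointCount A Y B ω * c) = ENNReal.ofReal ((1 / 2) ^ k) := by
        rw [← hk, ENat.toENNReal_coe, expNeg_nat_mul, hexp1, ENNReal.ofReal_pow (by norm_num)]
      rw [mul_add, expNeg_add, hw, ← ENNReal.ofReal_mul (by norm_num),
        ← ENNReal.ofReal_mul (by positivity), ← ENNReal.ofReal_add (by norm_num) (by positivity)]
      by_cases h2k : 2 ≤ k
      · rw [indicator_of_mem (by rw [mem_ofPred_eq, ← hk]; exact_mod_cast h2k),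
          ← ENNReal.ofReal_add (by norm_num) (by positivity)]
        refine ENNReal.ofReal_le_ofReal ?_
        have hle : ((1 : ℝ) / 2) ^ k ≤ (1 / 2) ^ 2 :=
          pow_le_pow_of_le_one (by norm_num) (by norm_num) h2k
        nlinarith
      · rw [indicator_of_notMem (by rw [mem_ofPred_eq, ← hk]; exact_mod_cast h2k), zero_add]
        refine ENNReal.ofReal_le_ofReal ?_
        have : k = 0 ∨ k = 1 := by omega
        rcases this with rfl | rfl <;> norm_num
  have hint := lintegral_mono (μ := P) hpt
  rw [lintegral_add_left (measurable_const.indicator hset), lintegral_indicator_const hset,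
    lintegral_const_mul _ (H.measurable_expNeg_count hB c), lintegral_add_left measurable_const,
    h1, h2, lintegral_const, measure_univ, mul_one] at hint
  set p := P {ω | 2 ≤ pointCount A Y B ω} with hp
  have hpt : p ≠ ∞ := measure_ne_top _ _
  rw [← ENNReal.ofReal_toReal hpt, ← ENNReal.ofReal_mul (by norm_num),
    ← ENNReal.ofReal_mul (by norm_num), ← ENNReal.ofReal_add (by positivity) (by positivity),
    ← ENNReal.ofReal_add (by positivity) (by positivity),
    ENNReal.ofReal_le_ofReal_iff (by positivity)] at hint
  rw [← ENNReal.ofReal_toReal hpt]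
  refine ENNReal.ofReal_le_ofReal ?_
  -- After integration the constant and linear terms in `μ` cancel, leaving `(3/16) p ≤ (9/16) μ^2`.
  have e1 := Real.add_one_le_exp (-((1 - 1 / 2) * μ))
  have e2 : Real.exp (-((1 - 1 / 4) * μ)) ≤ 1 - 3 / 4 * μ + (3 / 4 * μ) ^ 2 := by
    -- With `y = 3μ/4`, `e^(-y) ≤ 1/(1 + y) ≤ 1 - y + y^2`, since `(1 + y)(1 - y + y^2) = 1 + y^3`.
    have h3 := Real.add_one_le_exp ((1 - 1 / 4) * μ)
    rw [Real.exp_neg]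
    refine (inv_anti₀ (by positivity) h3).trans ?_
    rw [inv_le_iff_one_le_mul₀ (by positivity)]
    have : 0 ≤ μ ^ 3 := by positivity
    nlinarith
  nlinarith

end HasPoissonLaplace

end Independence

/-! ### Almost sure existence of a strictly increasing arrangement. -/

section Orderable

variable {Ω : Type*} [MeasurableSpace Ω] {P : Measure Ω} [IsProbabilityMeasure P] {α κ : ℝ}
  {A : Ω → Set ℕ} {Y : ℕ → Ω → ℝ}

lemma powerIntensity_univ (hα : 2 < α) (hκ : 0 < κ) : powerIntensity α κ univ = ∞ := by
  refine ENNReal.eq_top_of_forall_nnreal_le fun r => ?_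
  have hc : 0 < κ * (α / 2) := by have : 0 < α := by linarith
                                  positivity
  -- The level at which `(-∞, t]` has intensity exactly `r`.
  set t : ℝ := (r / (κ * (α / 2))) ^ (α / 2) with ht
  have hrc : 0 ≤ r / (κ * (α / 2)) := by positivity
  have h := powerIntensity_Iic hα hκ.le (t := t) (Real.rpow_nonneg hrc _)
  rw [ht, ← Real.rpow_mul hrc, div_mul_div_cancel₀ (by norm_num), div_self (by linarith),
    Real.rpow_one, mul_div_cancel₀ _ hc.ne', ENNReal.ofReal_coe_nnreal] at h
  exact h ▸ measure_mono (subset_univ _)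

namespace HasPoissonLaplace

/-- Cut a bounded range into cells of intensity `c / m`. A coincidence puts two points in one of the
`K m` cells, which has probability at most `K m · 3 (c / m)^2`, and this tends to 0 as `m` grows. -/
lemma ae_injOn (hα : 2 < α) (hκ : 0 < κ)
    (H : HasPoissonLaplace P (powerIntensity α κ) A Y) :
    ∀ᵐ ω ∂P, ∀ i ∈ A ω, ∀ j ∈ A ω, 0 < Y i ω → Y i ω = Y j ω → i = j := by
  have hα2 : 0 < α / 2 := by linarith
  set c := κ * (α / 2) with hc
  have hc0 : 0 < c := by positivity
  have key (K : ℕ) : ∀ᵐ ω ∂P, ∀ i ∈ A ω, ∀ j ∈ A ω, Y i ω ∈ Ioc 0 ((K : ℝ) ^ (α / 2)) →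
      Y i ω = Y j ω → i = j := by
    rw [ae_iff]
    set E := {ω | ¬ ∀ i ∈ A ω, ∀ j ∈ A ω, Y i ω ∈ Ioc 0 ((K : ℝ) ^ (α / 2)) →
      Y i ω = Y j ω → i = j} with hE
    have hle (m : ℕ) (hm : 0 < m) : P E ≤ ENNReal.ofReal (K * (3 * c ^ 2) * (m : ℝ)⁻¹) := by
      have hm' : (0 : ℝ) < m := by exact_mod_cast hm
      -- The exponent `α / 2` makes all cells equal in intensity, since `t j ^ (2 / α) = j / m`.
      let t : ℕ → ℝ := fun j => ((j : ℝ) / m) ^ (α / 2)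
      have ht : Monotone t := fun j k hjk =>
        Real.rpow_le_rpow (by positivity) (by gcongr) hα2.le
      have htp (j : ℕ) : t j ^ (2 / α) = j / m := by
        have : α ≠ 0 := by linarith
        rw [← Real.rpow_mul (by positivity), show α / 2 * (2 / α) = 1 by field_simp, Real.rpow_one]
      have hcell (j : ℕ) : powerIntensity α κ (Ioc (t j) (t (j + 1))) = ENNReal.ofReal (c / m) := by
        rw [powerIntensity_Ioc hα hκ.le (Real.rpow_nonneg (by positivity) _) (ht (Nat.le_succ j)),
          htp, htp]
        congr 1
        push_cast
        field_simp
        ring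
      have hcover : Ioc 0 ((K : ℝ) ^ (α / 2)) = ⋃ j ∈ Ico 0 (K * m), Ioc (t j) (t (j + 1)) := by
        have := ht.biUnion_Ico_Ioc_map_succ 0 (K * m)
        simp only [Nat.succ_eq_succ, Nat.succ_eq_add_one] at this
        rw [this]
        congr 1
        · simp [t, Real.zero_rpow hα2.ne']
        · simp only [t]
          push_cast
          rw [mul_div_cancel_right₀ _ hm'.ne']
      have hsub : E ⊆ ⋃ j ∈ Finset.range (K * m),
          {ω | 2 ≤ pointCount A Y (Ioc (t j) (t (j + 1))) ω} := by
        intro ω hω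
        simp only [hE, mem_ofPred_eq, not_forall] at hω
        obtain ⟨i, hi, j, hj, hY, hij, hne⟩ := hω
        rw [hcover] at hY
        simp only [mem_iUnion, exists_prop] at hY
        obtain ⟨l, hl, hYl⟩ := hY
        simp only [mem_iUnion, exists_prop]
        refine ⟨l, Finset.mem_range.2 hl.2, ?_⟩
        rw [mem_ofPred_eq, pointCount, ← encard_pair hne]
        refine encard_le_encard ?_
        rintro k (rfl | rfl)
        · exact ⟨hi, hYl⟩
        · exact ⟨hj, hij ▸ hYl⟩
      calc P E ≤ ∑ j ∈ Finset.range (K * m),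
            P {ω | 2 ≤ pointCount A Y (Ioc (t j) (t (j + 1))) ω} :=
            (measure_mono hsub).trans (measure_biUnion_finset_le _ _)
        _ ≤ ∑ j ∈ Finset.range (K * m), ENNReal.ofReal (3 * (c / m) ^ 2) :=
            Finset.sum_le_sum fun j _ => H.measure_two_le_pointCount_le measurableSet_Ioc
              (by positivity) (hcell j)
        _ = _ := by
            rw [Finset.sum_const, Finset.card_range, nsmul_eq_mul, ← ENNReal.ofReal_natCast,
              ← ENNReal.ofReal_mul (by positivity)]
            congr 1
            push_cast
            field_simp
    have hlim : Tendsto (fun m : ℕ => ENNReal.ofReal (K * (3 * c ^ 2) * (m : ℝ)⁻¹)) atTop (𝓝 0) := by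
      have := ENNReal.tendsto_ofReal
        ((tendsto_inv_atTop_nhds_zero_nat (𝕜 := ℝ)).const_mul (K * (3 * c ^ 2)))
      simpa using this
    refine le_antisymm (ge_of_tendsto hlim ?_) zero_le
    filter_upwards [eventually_gt_atTop 0] with m hm using hle m hm
  filter_upwards [ae_all_iff.2 key] with ω hω i hi j hj hpos hij
  obtain ⟨K, hK⟩ := exists_nat_ge (Y i ω ^ (2 / α))
  refine hω K i hi j hj ⟨hpos, ?_⟩ hij
  have h1 := Real.rpow_le_rpow (Real.rpow_nonneg hpos.le _) hK hα2.le
  have : α ≠ 0 := by linarith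
  rwa [← Real.rpow_mul hpos.le, show 2 / α * (α / 2) = 1 by field_simp, Real.rpow_one] at h1

lemma ae_pos (H : HasPoissonLaplace P (powerIntensity α κ) A Y) :
    ∀ᵐ ω ∂P, ∀ i ∈ A ω, 0 < Y i ω := by
  filter_upwards [H.ae_pointCount_eq_zero measurableSet_Iic powerIntensity_Iic_zero] with ω hω i hi
  by_contra! h
  have : {i | i ∈ A ω ∧ Y i ω ∈ Iic 0} = ∅ := encard_eq_zero.1 hω
  exact (this ▸ show i ∈ {i | i ∈ A ω ∧ Y i ω ∈ Iic 0} from ⟨hi, h⟩ : i ∈ (∅ : Set ℕ))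

lemma ae_isOrderable (hα : 2 < α) (hκ : 0 < κ)
    (H : HasPoissonLaplace P (powerIntensity α κ) A Y) :
    ∀ᵐ ω ∂P, IsOrderable (A ω) fun i => Y i ω := by
  have hfin : ∀ᵐ ω ∂P, ∀ K : ℕ, pointCount A Y (Iic (K : ℝ)) ω ≠ ⊤ := by
    refine ae_all_iff.2 fun K => H.ae_pointCount_ne_top measurableSet_Iic ?_
    rw [powerIntensity_Iic hα hκ.le K.cast_nonneg]
    exact ENNReal.ofReal_ne_top
  filter_upwards [H.ae_injOn hα hκ, H.ae_pos, hfin,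
    H.ae_pointCount_eq_top MeasurableSet.univ (powerIntensity_univ hα hκ)] with ω h1 h2 h3 h4
  refine ⟨?_, fun i hi j hj hij => h1 i hi j hj (h2 i hi) hij, fun t => ?_⟩
  · rw [← encard_eq_top_iff]
    simpa [pointCount] using h4
  · obtain ⟨K, hK⟩ := exists_nat_ge t
    exact (encard_ne_top_iff.1 (h3 K)).subset fun i hi => ⟨hi.1, hi.2.trans hK⟩

end HasPoissonLaplace

end Orderable

/-! ### From the nodes and gains to the process of inverse powers. -/

section Network

/-- The inverse received powers of the interferers have the Laplace functional of a Poisson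
process. -/
lemma hasPoissonLaplace_inversePower {Ω : Type*} [MeasurableSpace Ω] {P : Measure Ω}
    [IsProbabilityMeasure P] {lam α φ : ℝ} (hlam : 0 < lam) (hα : 2 < α) (hφ0 : 0 < φ)
    (hφ1 : φ ≤ 2 * Real.pi) (x : Plane) {X : ℕ → Ω → Plane}
    (hX : IsPoissonPointProcess P (ENNReal.ofReal lam • volume) X)
    {ν : Measure ℝ} {h : ℕ → Ω → ℝ} (h_meas : ∀ i, Measurable (h i))
    (h_law : ∀ i, P.map (h i) = ν) (h_pos : ∀ᵐ t ∂ν, 0 < t) (h_indep : iIndepFun h P)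
    (hX_indep : IndepFun (fun ω i => X i ω) (fun ω i => h i ω) P)
    (h_mom : Integrable (fun t : ℝ => t ^ (2 / α)) ν) :
    HasPoissonLaplace P (powerIntensity α (φ * lam / α * ∫ t, t ^ (2 / α) ∂ν))
      (interferers x φ X) (inversePower x α X h) where
  measurableSet_mem i := by
    exact measurableSet_le (measurable_polarAngle.comp ((hX.measurable i).sub_const x))
      measurable_const
  measurable i := by
    have := hX.measurable i
    have := h_meas i
    unfold inversePower
    fun_prop
  laplace f hf := by
    classical
    have hν : IsProbabilityMeasure ν := h_law 0 ▸ Measure.isProbabilityMeasure_map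
      (h_meas 0).aemeasurable
    have hS : SigmaFinite (ENNReal.ofReal lam • volume : Measure Plane) :=
      inferInstanceAs (SigmaFinite (lam.toNNReal • volume))
    have hY : Measurable fun p : Plane × ℝ => ‖p.1 - x‖ ^ α / p.2 := by fun_prop
    have hC : MeasurableSet {p : Plane × ℝ | polarAngle (p.1 - x) ≤ φ} :=
      measurableSet_le (by fun_prop) measurable_const
    -- Nodes outside the reception angle contribute the neutral factor 1.
    let G : Plane → ℝ → ℝ≥0∞ := fun p η =>
      if polarAngle (p - x) ≤ φ then expNeg (f (‖p - x‖ ^ α / η)) else 1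
    have hG : Measurable (Function.uncurry G) :=
      Measurable.ite hC (measurable_expNeg.comp (hf.comp hY)) measurable_const
    have hG1 (p : Plane) (η : ℝ) : G p η ≤ 1 := by
      simp only [G]
      split_ifs
      exacts [expNeg_le_one _, le_rfl]
    have h1 := hX.lintegral_infProd_marked h_meas h_law h_indep hX_indep hG hG1
    have h2 (ω : Ω) : expNeg (pointSum (interferers x φ X) (inversePower x α X h) f ω) =
        infProd fun i => G (X i ω) (h i ω) := by
      rw [pointSum, ← infProd_expNeg]
      congr 1
      ext i
      by_cases hi : polarAngle (X i ω - x) ≤ φ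
      · rw [indicator_of_mem (show i ∈ interferers x φ X ω from hi)]
        simp [G, hi, inversePower]
      · rw [indicator_of_notMem (show i ∉ interferers x φ X ω from hi)]
        simp [G, hi]
    simp_rw [h2]
    rw [h1, ← map_inversePower x hlam hα hφ0 hφ1 ν h_pos h_mom, lintegral_map (by fun_prop) hY,
      ← lintegral_indicator hC, ← lintegral_prod (fun p : Plane × ℝ => 1 - G p.1 p.2)
        (measurable_const.sub hG).aemeasurable]
    congr 1
    refine lintegral_congr fun p => ?_
    by_cases hp : polarAngle (p.1 - x) ≤ φ
    · rw [indicator_of_mem (by exact hp)]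
      simp [G, hp]
    · rw [indicator_of_notMem (by exact hp)]
      simp [G, hp]

end Network

/-! ### The interference beyond a fixed or random level. -/

section Tail

/-- The received power `s / y` of a point `y` above the level `b`. -/
def tailPower (s b : ℝ) : ℝ → ℝ≥0∞ := (Ioi b).indicator fun y => ENNReal.ofReal (s / y)

lemma measurable_tailPower_uncurry (s : ℝ) : Measurable (Function.uncurry (tailPower s)) := by
  have : Function.uncurry (tailPower s) =
      {p : ℝ × ℝ | p.1 < p.2}.indicator fun p => ENNReal.ofReal (s / p.2) := by
    ext p; simp only [Function.uncurry, tailPower, indicator, mem_Ioi, mem_ofPred_eq]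
  rw [this]
  exact Measurable.indicator (by fun_prop) (measurableSet_lt measurable_fst measurable_snd)

lemma measurable_tailPower (s b : ℝ) : Measurable (tailPower s b) :=
  (measurable_tailPower_uncurry s).comp measurable_prodMk_left

lemma tailPower_ne_top (s b y : ℝ) : tailPower s b y ≠ ∞ := by
  by_cases h : y ∈ Ioi b <;> simp [tailPower, indicator, h]

variable {α κ : ℝ}

lemma lintegral_tailPower (hα : 2 < α) (hκ : 0 ≤ κ) {s b : ℝ} (hs : 0 < s) (hb : 0 < b) :
    ∫⁻ y, 1 - expNeg (tailPower s b y) ∂powerIntensity α κ =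
      ENNReal.ofReal (-(κ * q α b s)) := by
  have hm : Measurable fun y => 1 - expNeg (tailPower s b y) := by
    have := measurable_tailPower s b
    fun_prop
  rw [powerIntensity, lintegral_withDensity_eq_lintegral_mul _ (by fun_prop) hm,
    ← lintegral_indicator measurableSet_Ioi, ← mul_neg, ENNReal.ofReal_mul hκ,
    ← lintegral_one_sub_exp_mul_rpow hα hb hs, ← lintegral_const_mul' _ _ ENNReal.ofReal_ne_top,
    ← lintegral_indicator measurableSet_Ioi]
  refine lintegral_congr fun y => ?_
  by_cases hy : b < y
  · have hy0 : 0 < y := hb.trans hy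
    rw [indicator_of_mem (mem_Ioi.2 hy0), indicator_of_mem (mem_Ioi.2 hy)]
    have h1 : Real.exp (-(s / y)) ≤ 1 := Real.exp_le_one_iff.2 (by simpa using (div_pos hs hy0).le)
    simp only [Pi.mul_apply, tailPower, indicator_of_mem (mem_Ioi.2 hy)]
    rw [expNeg_ofReal (div_pos hs hy0).le, ← ENNReal.ofReal_one,
      ← ENNReal.ofReal_sub _ (Real.exp_pos _).le, ENNReal.ofReal_mul hκ,
      ENNReal.ofReal_mul (by linarith)]
    ring
  · rw [indicator_of_notMem (show y ∉ Ioi b from hy)]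
    by_cases hy0 : y ∈ Ioi (0 : ℝ)
    · rw [indicator_of_mem hy0]
      simp [tailPower, indicator_of_notMem (show y ∉ Ioi b from hy)]
    · rw [indicator_of_notMem hy0]

variable {Ω : Type*} {A : Ω → Set ℕ} {Y : ℕ → Ω → ℝ}

/-- There is no point strictly between consecutive order statistics, so the tail sum does not change
while `b` stays in that gap. -/
lemma IsOrderable.eventually_pointSum_tailPower {ω : Ω} (h : IsOrderable (A ω) fun i => Y i ω)
    {n : ℕ} (hn : 1 ≤ n) (s : ℝ) :
    ∀ᶠ b in 𝓝[>] (orderStat (A ω) (fun i => Y i ω) n), pointSum A Y (tailPower s b) ω =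
      pointSum A Y (tailPower s (orderStat (A ω) (fun i => Y i ω) n)) ω := by
  have hlt := (h.orderStat_lt_iff hn (n := n + 1) (by omega)).2 (Nat.lt_succ_self n)
  filter_upwards [Ioo_mem_nhdsGT hlt] with b hb
  refine tsum_congr fun i => ?_
  by_cases hi : i ∈ A ω
  · rw [indicator_of_mem hi, indicator_of_mem hi]
    by_cases hY : orderStat (A ω) (fun i => Y i ω) n < Y i ω
    · have h1 : orderStat (A ω) (fun i => Y i ω) (n + 1) ≤ Y i ω := by
        obtain ⟨m, hm, hmi⟩ := h.exists_orderStat_eq hi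
        rw [← hmi] at hY ⊢
        have := (h.orderStat_lt_iff hn hm).1 hY
        by_contra! hc
        have := (h.orderStat_lt_iff hm (by omega)).1 hc
        omega
      rw [tailPower, tailPower, indicator_of_mem (mem_Ioi.2 (hb.2.trans_le h1)),
        indicator_of_mem (mem_Ioi.2 hY)]
    · rw [tailPower, tailPower, indicator_of_notMem (show Y i ω ∉ Ioi _ from hY),
        indicator_of_notMem fun h' => hY (hb.1.trans (mem_Ioi.1 h'))]
  · rw [indicator_of_notMem hi, indicator_of_notMem hi]

lemma IsOrderable.pointSum_tailPower {ω : Ω} (h : IsOrderable (A ω) fun i => Y i ω)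
    {n : ℕ} (hn : 1 ≤ n) (s : ℝ) :
    pointSum A Y (tailPower s (orderStat (A ω) (fun i => Y i ω) n)) ω =
      ∑' k : ℕ, ENNReal.ofReal (s / orderStat (A ω) (fun i => Y i ω) (n + 1 + k)) := by
  rw [h.tsum_orderStat hn fun y => ENNReal.ofReal (s / y)]
  refine tsum_congr fun i => ?_
  by_cases hi : i ∈ A ω <;> by_cases hY : orderStat (A ω) (fun i => Y i ω) n < Y i ω <;>
    simp [indicator, hi, hY, tailPower]

variable [MeasurableSpace Ω] {P : Measure Ω}

namespace HasPoissonLaplace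

lemma lintegral_expNeg_tailPower (hα : 2 < α) (hκ : 0 < κ)
    (H : HasPoissonLaplace P (powerIntensity α κ) A Y) {s b : ℝ} (hs : 0 < s) (hb : 0 < b) :
    ∫⁻ ω, expNeg (pointSum A Y (tailPower s b) ω) ∂P =
      ENNReal.ofReal (Real.exp (κ * q α b s)) := by
  rw [H.laplace _ (measurable_tailPower s b), lintegral_tailPower hα hκ.le hs hb,
    expNeg_ofReal, neg_neg]
  have := mul_nonneg hκ.le (neg_nonneg.2 (q_nonpos hα hb hs))
  linarith

variable [IsProbabilityMeasure P]

lemma ae_pointSum_tailPower_ne_top (hα : 2 < α) (hκ : 0 < κ)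
    (H : HasPoissonLaplace P (powerIntensity α κ) A Y) {s b : ℝ} (hs : 0 < s) (hb : 0 < b) :
    ∀ᵐ ω ∂P, pointSum A Y (tailPower s b) ω ≠ ∞ :=
  H.ae_pointSum_ne_top (measurable_tailPower s b) (tailPower_ne_top s b)
    (by rw [lintegral_tailPower hα hκ.le hs hb]; exact ENNReal.ofReal_ne_top)

variable {n : ℕ} {z : Ω → ℝ}

/-- Given that the `n`-th order statistic is at most `b`, the points above `b` are independent of
it. -/
lemma setLIntegral_tailPower_of_le (hα : 2 < α) (hκ : 0 < κ)
    (H : HasPoissonLaplace P (powerIntensity α κ) A Y) (hn : 1 ≤ n) (hz : Measurable z)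
    (hzn : ∀ᵐ ω ∂P, z ω = orderStat (A ω) (fun i => Y i ω) n) (s b : ℝ) {B : Set ℝ}
    (hB : MeasurableSet B) (hBb : B ⊆ Iic b) :
    ∫⁻ ω in z ⁻¹' B, expNeg (pointSum A Y (tailPower s b) ω) ∂P =
      (∫⁻ ω, expNeg (pointSum A Y (tailPower s b) ω) ∂P) * P (z ⁻¹' B) := by
  set D : Ω → ℝ≥0∞ := fun ω => expNeg (pointSum A Y (tailPower s b) ω) with hD
  have hL1 : ∫⁻ ω, D ω ∂P ≤ 1 := by
    simpa using lintegral_mono (μ := P) fun ω => expNeg_le_one (pointSum A Y (tailPower s b) ω)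
  have hLt : ∫⁻ ω, D ω ∂P ≠ ∞ := (hL1.trans_lt ENNReal.one_lt_top).ne
  have : IsFiniteMeasure (P.withDensity D) := isFiniteMeasure_withDensity hLt
  have hm : ((P.withDensity D).map z).restrict (Iic b) =
      (∫⁻ ω, D ω ∂P) • (P.map z).restrict (Iic b) := by
    have : IsFiniteMeasure ((∫⁻ ω, D ω ∂P) • (P.map z).restrict (Iic b)) :=
      Measure.smul_finite _ hLt
    refine Measure.ext_of_Iic _ _ fun a => ?_
    -- This turns the event about the order statistic into an event about the number of points in a
    -- half-line below `b`.
    have hset : z ⁻¹' Iic (min a b) =ᵐ[P]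
        {ω | (n : ℕ∞) ≤ pointCount A Y (Iic (min a b)) ω} := by
      filter_upwards [hzn, H.ae_isOrderable hα hκ] with ω h1 h2
      refine propext ?_
      change z ω ≤ min a b ↔ _
      rw [h1, h2.orderStat_le_iff hn]
      rfl
    have hM : powerIntensity α κ (Iic (min a b)) ≠ ∞ := by
      -- The level may be negative, while the intensity formula requires a nonnegative one.
      refine ne_top_of_le_ne_top ?_ (measure_mono (Iic_subset_Iic.2 (le_max_right 0 (min a b))))
      rw [powerIntensity_Iic hα hκ.le (le_max_left _ _)]
      exact ENNReal.ofReal_ne_top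
    have key := H.setLIntegral_expNeg_pointSum measurableSet_Iic hM (measurable_tailPower s b)
      (fun y hy => indicator_of_notMem
        (fun h => absurd (hy.trans (min_le_right a b)) (not_le.2 (mem_Ioi.1 h))) _) n
    rw [Measure.smul_apply, Measure.restrict_apply measurableSet_Iic,
      Measure.restrict_apply measurableSet_Iic, Iic_inter_Iic,
      Measure.map_apply hz measurableSet_Iic, Measure.map_apply hz measurableSet_Iic,
      withDensity_apply _ (hz measurableSet_Iic), setLIntegral_congr hset, measure_congr hset, key,
      smul_eq_mul]
  have h := congrArg (fun μ => μ B) hm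
  simp only [Measure.smul_apply, Measure.restrict_apply hB, inter_eq_left.2 hBb,
    Measure.map_apply hz hB, withDensity_apply _ (hz hB), smul_eq_mul] at h
  exact h

/-- The conditional Laplace transform of the sum beyond the `n`-th order statistic. -/
lemma setLIntegral_tailPower_orderStat (hα : 2 < α) (hκ : 0 < κ)
    (H : HasPoissonLaplace P (powerIntensity α κ) A Y) (hn : 1 ≤ n) (hz : Measurable z)
    (hzn : ∀ᵐ ω ∂P, z ω = orderStat (A ω) (fun i => Y i ω) n) {s : ℝ} (hs : 0 < s) {B : Set ℝ}
    (hB : MeasurableSet B) :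
    ∫⁻ ω in z ⁻¹' B, expNeg (pointSum A Y (tailPower s (z ω)) ω) ∂P =
      ∫⁻ ω in z ⁻¹' B, ENNReal.ofReal (Real.exp (κ * q α (z ω) s)) ∂P := by
  let L : ℝ → ℝ≥0∞ := fun b => ∫⁻ ω, expNeg (pointSum A Y (tailPower s b) ω) ∂P
  have hL1 (b : ℝ) : L b ≤ 1 := by
    simpa using lintegral_mono (μ := P) fun ω => expNeg_le_one (pointSum A Y (tailPower s b) ω)
  -- The next point of the grid of mesh `1 / (m + 1)`, strictly above `y`: strictness gives
  -- convergence within the right neighbourhood of `y`.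
  let c : ℕ → ℝ → ℝ := fun m y => ((⌊y * (m + 1)⌋ : ℝ) + 1) / (m + 1)
  have hc_lt (m : ℕ) (y : ℝ) : y < c m y := by
    rw [lt_div_iff₀ (by positivity)]
    exact Int.lt_floor_add_one _
  have hc_le (m : ℕ) (y : ℝ) : c m y ≤ y + 1 / (m + 1) := by
    rw [div_le_iff₀ (by positivity), add_mul, one_div_mul_cancel (by positivity)]
    gcongr
    exact Int.floor_le _
  have hc_lim (y : ℝ) : Tendsto (fun m => c m y) atTop (𝓝[>] y) := by
    refine tendsto_nhdsWithin_iff.2 ⟨?_, Eventually.of_forall fun m => hc_lt m y⟩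
    refine tendsto_of_tendsto_of_tendsto_of_le_of_le tendsto_const_nhds ?_
      (fun m => (hc_lt m y).le) (fun m => hc_le m y)
    simpa using (tendsto_const_nhds (x := y)).add (tendsto_one_div_add_atTop_nhds_zero_nat (𝕜 := ℝ))
  have hcm (m : ℕ) : Measurable (c m) := by
    have : Measurable fun y : ℝ => ((⌊y * (m + 1)⌋ : ℤ) : ℝ) :=
      (measurable_of_countable (fun k : ℤ => (k : ℝ))).comp
        (Int.measurable_floor.comp (measurable_id.mul_const _))
    exact (this.add_const 1).div_const _
  -- On each grid cell the level is constant and bounds the cell from above, so the independence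
  -- statement at a fixed level applies.
  have hdisc (m : ℕ) : ∫⁻ ω in z ⁻¹' B, expNeg (pointSum A Y (tailPower s (c m (z ω))) ω) ∂P =
      ∫⁻ ω in z ⁻¹' B, L (c m (z ω)) ∂P := by
    let T : ℤ → Set ℝ := fun j => B ∩ (fun y : ℝ => ⌊y * (m + 1)⌋) ⁻¹' {j}
    have hfl : Measurable fun y : ℝ => ⌊y * ((m : ℝ) + 1)⌋ :=
      Int.measurable_floor.comp (measurable_id.mul_const _)
    have hT (j : ℤ) : MeasurableSet (T j) := hB.inter (hfl (measurableSet_singleton j))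
    have hBT : z ⁻¹' B = ⋃ j, z ⁻¹' T j := by
      ext ω; simp [T]
    have hdis : Pairwise (Function.onFun Disjoint fun j => z ⁻¹' T j) := fun j k hjk =>
      Disjoint.preimage _ (disjoint_left.2 fun y h1 h2 => hjk (h1.2.symm.trans h2.2))
    rw [hBT, lintegral_iUnion (fun j => hz (hT j)) hdis, lintegral_iUnion (fun j => hz (hT j)) hdis]
    refine tsum_congr fun j => ?_
    have hcj (y : ℝ) (hy : y ∈ T j) : c m y = ((j : ℝ) + 1) / (m + 1) := by
      have : ⌊y * ((m : ℝ) + 1)⌋ = j := hy.2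
      simp only [c, this]
    have e1 : ∫⁻ ω in z ⁻¹' T j, expNeg (pointSum A Y (tailPower s (c m (z ω))) ω) ∂P =
        ∫⁻ ω in z ⁻¹' T j, expNeg (pointSum A Y (tailPower s (((j : ℝ) + 1) / (m + 1))) ω) ∂P :=
      setLIntegral_congr_fun (hz (hT j)) fun ω hω => by simp only [hcj _ hω]
    have e2 : ∫⁻ ω in z ⁻¹' T j, L (c m (z ω)) ∂P =
        ∫⁻ _ in z ⁻¹' T j, L (((j : ℝ) + 1) / (m + 1)) ∂P :=
      setLIntegral_congr_fun (hz (hT j)) fun ω hω => by simp only [hcj _ hω]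
    rw [e1, e2, setLIntegral_const]
    refine H.setLIntegral_tailPower_of_le hα hκ hn hz hzn s _ (hT j) fun y hy => ?_
    rw [mem_Iic, ← hcj y hy]
    exact (hc_lt m y).le
  have hlim1 : Tendsto (fun m =>
      ∫⁻ ω in z ⁻¹' B, expNeg (pointSum A Y (tailPower s (c m (z ω))) ω) ∂P) atTop
      (𝓝 (∫⁻ ω in z ⁻¹' B, expNeg (pointSum A Y (tailPower s (z ω)) ω) ∂P)) := by
    refine tendsto_lintegral_of_dominated_convergence (fun _ => 1) (fun m =>
      measurable_expNeg.comp (H.measurable_pointSum_comp (measurable_tailPower_uncurry s)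
        ((hcm m).comp hz))) (fun m => ae_of_all _ fun ω => expNeg_le_one _) (by simp) ?_
    filter_upwards [ae_restrict_of_ae hzn, ae_restrict_of_ae (H.ae_isOrderable hα hκ)]
      with ω h1 h2
    refine tendsto_const_nhds.congr' ?_
    have := (hc_lim (z ω)).eventually (h1 ▸ h2.eventually_pointSum_tailPower hn s)
    filter_upwards [this] with m hm
    rw [hm]
  have hlim2 : Tendsto (fun m => ∫⁻ ω in z ⁻¹' B, L (c m (z ω)) ∂P) atTop
      (𝓝 (∫⁻ ω in z ⁻¹' B, ENNReal.ofReal (Real.exp (κ * q α (z ω) s)) ∂P)) := by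
    have hLm (m : ℕ) : Measurable fun y => L (c m y) :=
      (measurable_of_countable (fun k : ℤ => L (((k : ℝ) + 1) / (m + 1)))).comp
        (Int.measurable_floor.comp (measurable_id.mul_const _))
    refine tendsto_lintegral_of_dominated_convergence (fun _ => 1) (fun m => (hLm m).comp hz)
      (fun m => ae_of_all _ fun ω => hL1 _) (by simp) ?_
    filter_upwards [ae_restrict_of_ae hzn, ae_restrict_of_ae (H.ae_isOrderable hα hκ),
      ae_restrict_of_ae H.ae_pos] with ω h1 h2 h3
    obtain ⟨i, hi, hiz⟩ := h2.orderStat_mem hn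
    have hz0 : 0 < z ω := by rw [h1, ← hiz]; exact h3 i hi
    have hc0 (m : ℕ) : L (c m (z ω)) = ENNReal.ofReal (Real.exp (κ * q α (c m (z ω)) s)) :=
      H.lintegral_expNeg_tailPower hα hκ hs (hz0.trans (hc_lt m _))
    simp_rw [hc0]
    refine ENNReal.tendsto_ofReal ((Real.continuous_exp.tendsto _).comp (Tendsto.const_mul κ ?_))
    exact (continuousAt_q_left hα hz0 hs).tendsto.comp ((hc_lim _).mono_right nhdsWithin_le_nhds)
  simp_rw [hdisc] at hlim1
  exact tendsto_nhds_unique hlim1 hlim2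

end HasPoissonLaplace

end Tail

/-! ### Laplace transforms of regular conditional distributions. -/

section CondDistrib

variable {Ω : Type*} [MeasurableSpace Ω] {P : Measure Ω} [IsProbabilityMeasure P]

/-- The Laplace transform of a regular conditional distribution, simultaneously at all `s > 0`, from
its values integrated over the events of the conditioning variable. -/
lemma ae_integral_exp_condDistrib {Z I : Ω → ℝ} (hZ : Measurable Z) (hI : Measurable I)
    (hZ0 : ∀ᵐ ω ∂P, 0 < Z ω) (hI0 : ∀ᵐ ω ∂P, 0 ≤ I ω) {G : ℝ → ℝ → ℝ}
    (hGl : ∀ s, 0 < s → ∀ t, 0 < t → ContinuousAt (fun t => G t s) t)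
    (hGr : ∀ s, 0 < s → ∀ t, 0 < t → ContinuousAt (fun s => G t s) s)
    (h : ∀ s, 0 < s → ∀ B : Set ℝ, MeasurableSet B →
      ∫⁻ ω in Z ⁻¹' B, ENNReal.ofReal (Real.exp (-s * I ω)) ∂P =
        ∫⁻ ω in Z ⁻¹' B, ENNReal.ofReal (G (Z ω) s) ∂P) (hG0 : ∀ t s, 0 ≤ G t s) :
    ∀ᵐ ω ∂P, ∀ s : ℝ, 0 < s →
      ∫ u, Real.exp (-s * u) ∂(condDistrib I Z P (Z ω)) = G (Z ω) s := by
  have : IsProbabilityMeasure (P.map Z) := Measure.isProbabilityMeasure_map hZ.aemeasurable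
  have hcomp : (P.map Z) ⊗ₘ condDistrib I Z P = P.map fun ω => (Z ω, I ω) :=
    compProd_map_condDistrib hI.aemeasurable
  have hpos : ∀ᵐ t ∂P.map Z, 0 < t := (ae_map_iff hZ.aemeasurable measurableSet_Ioi).2 hZ0
  have hnonneg : ∀ᵐ t ∂P.map Z, ∀ᵐ u ∂condDistrib I Z P t, 0 ≤ u := by
    refine Measure.ae_ae_of_ae_compProd (p := fun p : ℝ × ℝ => 0 ≤ p.2) ?_
    rw [hcomp, ae_map_iff (hZ.prodMk hI).aemeasurable (measurableSet_le measurable_const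
      measurable_snd)]
    exact hI0
  have hfix (s : ℝ) (hs : 0 < s) : ∀ᵐ t ∂P.map Z,
      ∫⁻ u, ENNReal.ofReal (Real.exp (-s * u)) ∂(condDistrib I Z P t) =
        ENNReal.ofReal (G t s) := by
    have hgm : Measurable fun p : ℝ × ℝ => ENNReal.ofReal (Real.exp (-s * p.2)) := by fun_prop
    have hGm : AEMeasurable (fun t => ENNReal.ofReal (G t s)) (P.map Z) := by
      -- `G` is continuous only at positive `t`, which suffices because `Z` is almost surely
      -- positive.
      have h1 : (P.map Z).restrict (Ioi 0) = P.map Z :=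
        Measure.restrict_eq_self_of_ae_mem hpos
      rw [← h1]
      refine ENNReal.measurable_ofReal.comp_aemeasurable (ContinuousOn.aemeasurable ?_
        measurableSet_Ioi)
      exact fun t ht => (hGl s hs t ht).continuousWithinAt
    refine ae_eq_of_forall_setLIntegral_eq_of_sigmaFinite₀
      (Measurable.lintegral_kernel_prod_right' hgm).aemeasurable hGm fun B hB _ => ?_
    have h1 := Measure.setLIntegral_compProd (μ := P.map Z) (κ := condDistrib I Z P) hgm hB
      MeasurableSet.univ
    rw [hcomp, setLIntegral_map (hB.prod MeasurableSet.univ) hgm (hZ.prodMk hI)] at h1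
    simp only [Measure.restrict_univ] at h1
    have hGm' := hGm.restrict (s := B)
    rw [Measure.restrict_map hZ hB] at hGm'
    rw [← h1, Measure.restrict_map hZ hB, lintegral_map' hGm' hZ.aemeasurable, ← h s hs B hB]
    -- The product set `B ×ˢ univ` pulls back to `Z ⁻¹' B`.
    congr 2
    ext ω
    simp
  have hrat : ∀ᵐ t ∂P.map Z, ∀ r : ℚ, 0 < (r : ℝ) →
      ∫⁻ u, ENNReal.ofReal (Real.exp (-r * u)) ∂(condDistrib I Z P t) =
        ENNReal.ofReal (G t r) := by
    refine ae_all_iff.2 fun r => ?_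
    by_cases hr : 0 < (r : ℝ)
    · filter_upwards [hfix r hr] with t ht _ using ht
    · exact ae_of_all _ fun t h => absurd h hr
  refine ae_of_ae_map (p := fun t => ∀ s : ℝ, 0 < s →
    ∫ u, Real.exp (-s * u) ∂(condDistrib I Z P t) = G t s) hZ.aemeasurable ?_
  filter_upwards [hpos, hnonneg, hrat] with t ht hu hr s hs
  -- Rationals decreasing to `s` stay positive, so the identities at rational points pass to `s`;
  -- the exponentials are dominated by 1.
  obtain ⟨r, -, hrs, hrlim⟩ := Real.exists_seq_rat_strictAnti_tendsto s
  have hr0 (k : ℕ) : 0 < (r k : ℝ) := hs.trans (hrs k)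
  have h1 : Tendsto (fun k => ∫⁻ u, ENNReal.ofReal (Real.exp (-r k * u)) ∂(condDistrib I Z P t))
      atTop (𝓝 (∫⁻ u, ENNReal.ofReal (Real.exp (-s * u)) ∂(condDistrib I Z P t))) := by
    refine tendsto_lintegral_of_dominated_convergence (fun _ => 1) (fun k => by fun_prop)
      (fun k => ?_) (by simp) (ae_of_all _ fun u => ?_)
    · filter_upwards [hu] with u hu
      rw [← ENNReal.ofReal_one]
      refine ENNReal.ofReal_le_ofReal (Real.exp_le_one_iff.2 ?_)
      nlinarith [mul_nonneg (hr0 k).le hu]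
    · exact ENNReal.tendsto_ofReal ((Real.continuous_exp.tendsto _).comp
        (hrlim.neg.mul_const u))
  have h2 : Tendsto (fun k => ENNReal.ofReal (G t (r k))) atTop (𝓝 (ENNReal.ofReal (G t s))) :=
    ENNReal.tendsto_ofReal ((hGr s hs t ht).tendsto.comp hrlim)
  simp_rw [fun k => hr (r k) (hr0 k)] at h1
  rw [integral_eq_lintegral_of_nonneg_ae (ae_of_all _ fun u => (Real.exp_pos _).le)
    (by fun_prop), tendsto_nhds_unique h1 h2, ENNReal.toReal_ofReal (hG0 t s)]

end CondDistrib

/-! ### Measurability, convergence and the conditional transform. -/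

section Main

variable {Ω : Type*} [MeasurableSpace Ω] {P : Measure Ω} [IsProbabilityMeasure P] {α κ : ℝ}
  {A : Ω → Set ℕ} {Y : ℕ → Ω → ℝ} {n : ℕ}

namespace HasPoissonLaplace

/-- The event that the order statistic is at most `t` agrees with a counting event only where the
points are orderable, hence measurability up to null sets. -/
lemma aemeasurable_orderStat (hα : 2 < α) (hκ : 0 < κ)
    (H : HasPoissonLaplace P (powerIntensity α κ) A Y) (hn : 1 ≤ n) :
    AEMeasurable (fun ω => orderStat (A ω) (fun i => Y i ω) n) P := by
  refine NullMeasurable.aemeasurable (f := fun ω => orderStat (A ω) (fun i => Y i ω) n) ?_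
  refine measurable_of_Iic (δ := NullMeasurableSpace Ω P) fun t => ?_
  have hm : MeasurableSet {ω | (n : ℕ∞) ≤ pointCount A Y (Iic t) ω} :=
    H.measurable_pointCount measurableSet_Iic (MeasurableSet.of_discrete (s := Ici (n : ℕ∞)))
  refine hm.nullMeasurableSet.congr ?_
  filter_upwards [H.ae_isOrderable hα hκ] with ω hω
  exact propext (hω.orderStat_le_iff hn t).symm

lemma ae_orderStat_pos (hα : 2 < α) (hκ : 0 < κ)
    (H : HasPoissonLaplace P (powerIntensity α κ) A Y) :
    ∀ᵐ ω ∂P, ∀ n, 1 ≤ n → 0 < orderStat (A ω) (fun i => Y i ω) n := by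
  filter_upwards [H.ae_isOrderable hα hκ, H.ae_pos] with ω h1 h2 n hn
  obtain ⟨i, hi, hiz⟩ := h1.orderStat_mem hn
  exact hiz ▸ h2 i hi

/-- The tail sum is finite beyond each of the countably many levels `1 / (j + 1)` simultaneously,
and the positive `n`-th order statistic exceeds one of them. -/
lemma ae_tsum_orderStat_ne_top (hα : 2 < α) (hκ : 0 < κ)
    (H : HasPoissonLaplace P (powerIntensity α κ) A Y) (hn : 1 ≤ n) :
    ∀ᵐ ω ∂P, ∑' k : ℕ, ENNReal.ofReal (orderStat (A ω) (fun i => Y i ω) (n + 1 + k))⁻¹ ≠ ∞ := by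
  have hb (j : ℕ) := H.ae_pointSum_tailPower_ne_top hα hκ one_pos
    (Nat.one_div_pos_of_nat (α := ℝ) (n := j))
  filter_upwards [ae_all_iff.2 hb, H.ae_isOrderable hα hκ, H.ae_orderStat_pos hα hκ]
    with ω h1 h2 h3
  have h4 := h2.pointSum_tailPower hn 1
  simp only [one_div] at h4
  rw [← h4]
  obtain ⟨j, hj⟩ := exists_nat_one_div_lt (h3 n hn)
  refine ne_top_of_le_ne_top (h1 j) (ENNReal.tsum_le_tsum fun i => ?_)
  exact indicator_le_indicator (indicator_le_indicator_of_subset (Ioi_subset_Ioi hj.le)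
    (fun _ => zero_le) _)

lemma ae_summable_orderStat (hα : 2 < α) (hκ : 0 < κ)
    (H : HasPoissonLaplace P (powerIntensity α κ) A Y) (hn : 1 ≤ n) :
    ∀ᵐ ω ∂P, Summable fun k : ℕ => (orderStat (A ω) (fun i => Y i ω) (n + 1 + k))⁻¹ := by
  filter_upwards [H.ae_tsum_orderStat_ne_top hα hκ hn, H.ae_orderStat_pos hα hκ] with ω h1 h2
  refine (ENNReal.summable_toReal h1).congr fun k => ?_
  rw [ENNReal.toReal_ofReal (inv_nonneg.2 (h2 _ (by omega)).le)]

/-- The conditional Laplace transform of the sum of the inverses beyond the `n`-th order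
statistic. -/
lemma ae_integral_exp_condDistrib_orderStat (hα : 2 < α) (hκ : 0 < κ)
    (H : HasPoissonLaplace P (powerIntensity α κ) A Y) (hn : 1 ≤ n) {Z I : Ω → ℝ}
    (hZ : ∀ ω, Z ω = orderStat (A ω) (fun i => Y i ω) n)
    (hI : ∀ ω, I ω = ∑' k : ℕ, (orderStat (A ω) (fun i => Y i ω) (n + 1 + k))⁻¹) :
    ∀ᵐ ω ∂P, ∀ s : ℝ, 0 < s → ∫ u, Real.exp (-s * u) ∂(condDistrib I Z P (Z ω)) =
      Real.exp (κ * q α (Z ω) s) := by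
  have hZm : AEMeasurable Z P := by
    rw [funext hZ]
    exact H.aemeasurable_orderStat hα hκ hn
  have hIm : AEMeasurable I P := by
    rw [funext hI]
    exact AEMeasurable.tsum fun k => (H.aemeasurable_orderStat hα hκ (by omega)).inv
  -- The conditional distribution depends only on the almost everywhere classes, so measurable
  -- versions may replace `Z` and `I`.
  have hZe := hZm.ae_eq_mk
  have hIe := hIm.ae_eq_mk
  have hZn : ∀ᵐ ω ∂P, hZm.mk Z ω = orderStat (A ω) (fun i => Y i ω) n := by
    filter_upwards [hZe] with ω h
    rw [← h, hZ]
  have key := ae_integral_exp_condDistrib (P := P) hZm.measurable_mk hIm.measurable_mk ?_ ?_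
    (G := fun t s => Real.exp (κ * q α t s))
    (fun s hs t ht => Real.continuous_exp.continuousAt.comp
      ((continuousAt_q_left hα ht hs).const_mul κ))
    (fun s hs t ht => Real.continuous_exp.continuousAt.comp
      ((continuousAt_q_right hα ht hs).const_mul κ))
    ?_ (fun _ _ => (Real.exp_pos _).le)
  · rw [condDistrib_congr hIe hZe]
    filter_upwards [key, hZe] with ω h1 h2
    rw [h2]
    exact h1
  · filter_upwards [hZn, H.ae_orderStat_pos hα hκ] with ω h1 h2
    rw [h1]
    exact h2 n hn
  · filter_upwards [hIe, H.ae_orderStat_pos hα hκ] with ω h1 h2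
    rw [← h1, hI]
    exact tsum_nonneg fun k => inv_nonneg.2 (h2 _ (by omega)).le
  · intro s hs B hB
    rw [← H.setLIntegral_tailPower_orderStat hα hκ hn hZm.measurable_mk hZn hs hB]
    refine lintegral_congr_ae (ae_restrict_of_ae ?_)
    filter_upwards [hIe, hZn, H.ae_isOrderable hα hκ, H.ae_orderStat_pos hα hκ,
      H.ae_summable_orderStat hα hκ hn] with ω h1 h2 h3 h4 h5
    have h6 (k : ℕ) : 0 ≤ s * (orderStat (A ω) (fun i => Y i ω) (n + 1 + k))⁻¹ :=
      mul_nonneg hs.le (inv_nonneg.2 (h4 _ (by omega)).le)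
    rw [h2, h3.pointSum_tailPower hn, ← h1, hI]
    simp_rw [div_eq_mul_inv]
    rw [← ENNReal.ofReal_tsum_of_nonneg h6 (h5.mul_left s), expNeg_ofReal (tsum_nonneg h6),
      tsum_mul_left, neg_mul]

end HasPoissonLaplace

end Main

end PoissonNetwork

end

theorem theorem2 {Ω : Type*} [MeasurableSpace Ω] (P : Measure Ω) [IsProbabilityMeasure P]
    (lam α φ : ℝ) (hlam : 0 < lam) (hα : 2 < α) (hφ0 : 0 < φ) (hφ1 : φ ≤ 2 * Real.pi)
    -- the receiver
    (x : PoissonNetwork.Plane)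
    -- the nodes: a homogeneous Poisson point process of intensity `lam`
    (X : ℕ → Ω → PoissonNetwork.Plane)
    (hX : PoissonNetwork.IsPoissonPointProcess P (ENNReal.ofReal lam • volume) X)
    -- the channel gains: positive, i.i.d. with law `ν`, independent of the nodes
    (ν : Measure ℝ) (h : ℕ → Ω → ℝ)
    (h_meas : ∀ i, Measurable (h i))
    (h_law : ∀ i, P.map (h i) = ν)
    (h_pos : ∀ᵐ t ∂ν, 0 < t)
    (h_indep : iIndepFun h P)
    (hX_indep : IndepFun (fun ω i => X i ω) (fun ω i => h i ω) P)
    (h_mom : Integrable (fun t : ℝ => t ^ (2 / α)) ν)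
    (n : ℕ) (hn : 1 ≤ n) :
    -- almost surely `z 1 < z 2 < …` enumerates all the inverse powers of the interferers,
    (∀ᵐ ω ∂P, StrictMono (fun k : ℕ => PoissonNetwork.z x φ α X h (k + 1) ω) ∧
      Set.range (fun k : ℕ => PoissonNetwork.z x φ α X h (k + 1) ω) =
        PoissonNetwork.powerPoints x φ α X h ω) ∧
    -- the series defining the partial accumulative interference converges,
    (∀ᵐ ω ∂P, Summable (fun k : ℕ => (PoissonNetwork.z x φ α X h (n + 1 + k) ω)⁻¹)) ∧
    -- and its conditional law given `z n` has the stated Laplace transform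
    (∀ᵐ ω ∂P, ∀ s : ℝ, 0 < s →
      ∫ u, Real.exp (-s * u) ∂(condDistrib (PoissonNetwork.partialInterference x φ α X h n)
          (PoissonNetwork.z x φ α X h n) P (PoissonNetwork.z x φ α X h n ω)) =
        Real.exp (φ * lam / α * (∫ t, t ^ (2 / α) ∂ν) *
          PoissonNetwork.q α (PoissonNetwork.z x φ α X h n ω) s)) := by
  have hν : IsProbabilityMeasure ν := h_law 0 ▸ Measure.isProbabilityMeasure_map
    (h_meas 0).aemeasurable
  -- Positive gains make the moment, and hence `κ`, strictly positive; this is what yields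
  -- infinitely many interferers.
  have hm : 0 < ∫ t, t ^ (2 / α) ∂ν := by
    rw [integral_pos_iff_support_of_nonneg_ae (h_pos.mono fun t ht => Real.rpow_nonneg ht.le _)
      h_mom]
    refine zero_lt_one.trans_le ?_
    rw [← measure_univ (μ := ν)]
    exact measure_mono_ae (h_pos.mono fun t ht _ => (Real.rpow_pos_of_pos ht _).ne')
  have hκ : 0 < φ * lam / α * ∫ t, t ^ (2 / α) ∂ν := by
    have : 0 < α := by linarith
    positivity
  have H := PoissonNetwork.hasPoissonLaplace_inversePower hlam hα hφ0 hφ1 x hX h_meas h_law h_pos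
    h_indep hX_indep h_mom
  refine ⟨?_, H.ae_summable_orderStat hα hκ hn,
    H.ae_integral_exp_condDistrib_orderStat hα hκ hn (fun _ => rfl) fun _ => rfl⟩
  filter_upwards [H.ae_isOrderable hα hκ] with ω hω
  exact ⟨hω.strictMono_orderStat, hω.range_orderStat⟩
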